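/- **Setting.** Fix a one-parameter exponential family of laws supported on $[0,1]$ (densities proportional to $e^{\theta S(x)}$ with respect to a reference measure, $\theta\in\Theta$) that is parameterized by its mean. An instance is $\nu=(\nu_i)_{i\in[L]}$ with $\nu_i$ in the family and means $\mu_i$; write $\Delta_i=\max_l\mu_l-\mu_i$, let $D$ be the Kullback–Leibler divergence, and put $x/0=\infty$ for $x>0$. For each horizon $T$ a (possibly randomized) policy $\pi=\pi^T$ pulls one item per step on the basis of the past pulls and rewards. The first $T_{FE}=g(T)$ steps are free, where $g:\mathbb N\to\mathbb N$, $g(T)\to\infty$ and $g(T)=O(\ln T)$. Let $T_{i,FE}$ be the number of free pulls of item $i$. For an instance with items relabelled so that $\mu_1\ge\dots\ge\mu_L$ and a real budget $B$, let $$i_{FE}=\max\Big\{j\in[L]:\sum_{i=j}^L\tfrac{\ln T}{D(\nu_i,\nu_1)}\ge B\Big\},\qquad \mathrm{Save}^*(\nu,B)=\Delta_{i_{FE}}\Big(B-\sum_{i>i_{FE}}\tfrac{\ln T}{D(\nu_i,\nu_1)}\Big)+\sum_{i>i_{FE}}\tfrac{\Delta_i\ln T}{D(\nu_i,\nu_1)},$$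 $$\widehat{\mathrm{Save}}(\pi;\nu)=\sum_{i:\Delta_i>0}\Delta_i\min\Big\{T_{i,FE},\tfrac{\ln T}{D(\nu_i,\nu_1)}\Big\},\qquad \widetilde{\mathrm{Save}}(\pi;\nu)=\sum_{i:\Delta_i>0}\Delta_i\min\Big\{\tfrac{\ln T}{D(\nu_i,\nu_1)},\mathbb E_\nu[T_{i,FE}]\Big\}.$$ For $\alpha,\beta\in(0,1)$, $\pi$ is *$(\alpha,\beta)$-probably saving* on a class of instances if for each $\nu$ in it there is a constant $C$ such that $\mathbb P_\nu(\widehat{\mathrm{Save}}(\pi;\nu)\ge\alpha\,\mathrm{Save}^*(\nu,T_{FE}))\ge1-CT^{-\beta}$ for all large $T$. Let $\nu$ be an instance with $\mu_1\ge\dots\ge\mu_L$. For each $T$ put $\bar\Delta=\mathrm{Save}^*(\nu,T_{FE})/T_{FE}$ and define the following objects (which depend on $T$). * $\mathcal L_g=\{i:\Delta_i<\bar\Delta-\frac{1-\alpha}{\alpha}\Delta_L\}$. A *first alternative instance* $\nu^{(1)}$ (for $\varepsilon_1>0$; it requires $\mathcal L_g\ne\emptyset$) has means $\frac{\mu_1+\mu_L-\varepsilon_1}2$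 for $i\in\mathcal L_g$ and $\frac{\mu_1+\mu_L+\varepsilon_1}2$ for $i\notin\mathcal L_g$, where $|\mathcal L_g|\ln T/D(\nu^{(1)}_i,\nu^{(1)}_L)>T_{FE}$ for $i\in\mathcal L_g$. * For $S\subset[L]$ let $\Delta_S=\max_{i\in S}\Delta_i$ and $i^\dagger=\min\{i:i\notin S\}$. The family $\mathcal S_c$ of permissible changed sets consists of all $S\subset[i_{FE}-1]$ (with $i_{FE}$ for $B=T_{FE}$) such that $\alpha\ge\frac{\Delta_L}{\Delta_L+\bar\Delta-\Delta_S}$, $\Delta_S<\alpha\bar\Delta$ and $|S|\ln T/D(\nu_L,\nu_{i^\dagger})>T_{FE}$. * $\mathcal S_S$ is the set of $\varepsilon>\varepsilon_S:=\frac{(1-\alpha)(\mu_{i^\dagger}-\mu_L)(\Delta_L-\Delta_S)}{\alpha(\bar\Delta+\Delta_L-\Delta_S)-\Delta_L}$ ($\varepsilon_S=\infty$ if the denominator is not positive) such that the family has a member $\nu_\varepsilon$ of mean $\mu_L-\varepsilon$ and $|S|\ln T/D(\nu_\varepsilon,\nu_{i^\dagger})\ge T_{FE}$. * If $\mathcal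 S_c\neq\emptyset$, let $i_c$ be the largest item that belongs to some $S\in\mathcal S_c$, and $k$ the least integer such that $\{i_c-k+1,\dots,i_c\}\cap[L]\in\mathcal S_c$. The groups are the disjoint sets of consecutive items $\mathcal L_j=\{i_c-jk+1,\dots,i_c-(j-1)k\}\cap[L]$, $j\in[J]$, where $J\ge0$ is any integer with $J=0$ or $(J-1)k<i_c$. If $\mathcal S_c=\emptyset$ then $J=0$. **Theorem.** 1. Let $\nu^{(1)}$ be an instance. If, for infinitely many $T$, $\nu^{(1)}$ is a first alternative instance (for a fixed $\varepsilon_1$) and $T_{FE}<\beta\ln T/\max_iD(\nu_i,\nu^{(1)}_i)$, then $\pi$ is not $(\alpha,\beta)$-probably saving on $\{\nu,\nu^{(1)}\}$. Moreover, for no single $T$ at which these two conditions hold can the policy satisfy $\mathbb P(\widehat{\mathrm{Save}}\ge\alpha\,\mathrm{Save}^*)\ge1-T^{-\beta}/2.4$ on both $\nu$ and $\nu^{(1)}$. 2. Suppose that $i_c,k,J$ and shifts $\varepsilon_1,\dots,\varepsilon_J$ do not depend on $T$ and that, for all large $T$, they are as above and $\varepsilon_j\in\mathcal S_{\mathcal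 L_j}$ for all $j\in[J]$. (If $J=0$, no condition on $i_c$ and $k$ is needed.) Let $\nu^{(2),j}$ be the instance with mean $\mu_L-\varepsilon_j$ for $i\in\mathcal L_j$ that agrees with $\nu$ off $\mathcal L_j$, and let $\pi$ be $(\alpha,\beta)$-probably saving on $\nu$ and all $\nu^{(2),j}$. With $r_j=\beta/\max_{i\in\mathcal L_j}D(\nu_i,\nu_i^{(2),j})$ and $T'_{FE}=T_{FE}-\sum_{j\in[J]}r_j\ln T$, $$\limsup_{T\to\infty}\frac{\widetilde{\mathrm{Save}}(\pi;\nu)}{\ln T}\le\sum_{j\in[J]}\frac{\beta\max_{i\in\mathcal L_j}\Delta_i}{\max_{i\in\mathcal L_j}D(\nu_i,\nu_i^{(2),j})}+\limsup_{T\to\infty}\frac{\mathrm{Save}^*(\nu,T'_{FE})}{\ln T},$$ and if $T_{FE}/\ln T$ converges, then the last $\limsup$ is a limit. -/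

import Mathlib

open MeasureTheory ProbabilityTheory Filter Topology
open scoped ENNReal

noncomputable section

namespace FreeExploration

/-- A one-parameter exponential family of laws on `[0,1]`, with densities proportional to
`exp (θ * stat x)` with respect to a reference measure, and parameterized by its mean:
distinct parameters have distinct means. -/
structure ExpFamily where
  base : Measure ℝ
  stat : ℝ → ℝ
  param : Set ℝ
  base_ne_zero : base ≠ 0
  base_supp : base (Set.Icc (0 : ℝ) 1)ᶜ = 0
  stat_meas : Measurable stat
  integrable_exp : ∀ θ ∈ param, Integrable (fun x => Real.exp (θ * stat x)) base
  mean_injOn : Set.InjOn (fun θ : ℝ => ∫ x, x ∂(base.tilted (fun x => θ * stat x))) param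

namespace ExpFamily

variable (F : ExpFamily)

/-- The member of the family with parameter `θ`. -/
def law (θ : F.param) : Measure ℝ := F.base.tilted (fun x => (θ : ℝ) * F.stat x)

/-- The mean of the member with parameter `θ`. -/
def mean (θ : F.param) : ℝ := ∫ x, x ∂(F.law θ)

/-- Kullback-Leibler divergence between two members. -/
def kl (θ θ' : F.param) : ℝ≥0∞ := InformationTheory.klDiv (F.law θ) (F.law θ')

/-- A bandit instance with `L` items: one member of the family for each item. -/
abbrev Inst (L : ℕ) : Type := Fin L → F.param

end ExpFamily

/-! ### Policies and the law of the history -/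

/-- The history after `n` steps: the pulled items and the observed rewards. -/
abbrev Hist (L n : ℕ) : Type := Fin n → Fin L × ℝ

/-- A (possibly randomized) policy: the item pulled at step `n + 1` is drawn from a probability
distribution that depends measurably on the history of the first `n` steps. -/
structure Policy (L : ℕ) where
  rule : (n : ℕ) → Kernel (Hist L n) (Fin L)
  markov : ∀ n, IsMarkovKernel (rule n)

section Model

variable {F : ExpFamily} {L : ℕ}

/-- The reward of item `i` has law `ν i`. -/
def rewardKernel (ν : F.Inst L) : Kernel (Fin L) ℝ :=
  Kernel.ofFunOfCountable (fun i => F.law (ν i))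

/-- Law of the next (item, reward) pair given the history of the first `n` steps. -/
def stepKernel (ν : F.Inst L) (π : Policy L) (n : ℕ) : Kernel (Hist L n) (Fin L × ℝ) :=
  (π.rule n) ⊗ₖ (Kernel.prodMkLeft (Hist L n) (rewardKernel ν))

/-- Law of the history of the first `n` steps when `π` is run on `ν`. -/
def histLaw (ν : F.Inst L) (π : Policy L) : (n : ℕ) → Measure (Hist L n)
  | 0 => Measure.dirac Fin.elim0
  | n + 1 => ((histLaw ν π n) ⊗ₘ (stepKernel ν π n)).map
      (fun p => (Fin.snoc p.1 p.2 : Hist L (n + 1)))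

/-- Number of pulls of item `i` in a history. -/
def pulls {n : ℕ} (h : Hist L n) (i : Fin L) : ℕ :=
  (Finset.univ.filter (fun t : Fin n => (h t).1 = i)).card

/-- Expected number of pulls of item `i` in the first `n` steps. -/
def expPulls (ν : F.Inst L) (π : Policy L) (n : ℕ) (i : Fin L) : ℝ≥0∞ :=
  ∫⁻ h, (pulls h i : ℝ≥0∞) ∂(histLaw ν π n)

end Model

/-! ### Gaps and saved regret. The items of an instance need not be sorted here. -/

section Saved

variable {F : ExpFamily} {L : ℕ} [NeZero L]

/-- A permutation that lists the items by nonincreasing mean (the identity if they are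
already sorted). -/
def order (ν : F.Inst L) : Equiv.Perm (Fin L) := Tuple.sort (fun i => -F.mean (ν i))

/-- An item of largest mean. -/
def best (ν : F.Inst L) : Fin L := order ν 0

/-- The optimality gap `Δ_i`. -/
def gap (ν : F.Inst L) (i : Fin L) : ℝ := F.mean (ν (best ν)) - F.mean (ν i)

/-- `ln T / D(ν_i, ν_best)`, with value `∞` when the divergence vanishes. -/
def cap (ν : F.Inst L) (T : ℕ) (i : Fin L) : ℝ≥0∞ :=
  ENNReal.ofReal (Real.log T) / F.kl (ν i) (ν (best ν))

/-- For items sorted by nonincreasing mean: the largest `j` such that the items `j, …, L`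
together need at least `B` pulls. -/
def iFE (ν : F.Inst L) (T : ℕ) (B : ℝ) : Fin L :=
  (Finset.univ.filter
    (fun j : Fin L => ENNReal.ofReal B ≤ ∑ i ∈ Finset.Ici j, cap ν T i)).sup id

/-- The oracle saved regret with budget `B`, for items sorted by nonincreasing mean. -/
def saveStarSorted (ν : F.Inst L) (T : ℕ) (B : ℝ) : ℝ :=
  gap ν (iFE ν T B) * (B - ∑ i ∈ Finset.Ioi (iFE ν T B), (cap ν T i).toReal)
    + ∑ i ∈ Finset.Ioi (iFE ν T B), gap ν i * (cap ν T i).toReal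

/-- The oracle saved regret with budget `B` and horizon `T`: the items are first relabelled by
nonincreasing mean. -/
def saveStar (ν : F.Inst L) (T : ℕ) (B : ℝ) : ℝ :=
  saveStarSorted (fun i => ν (order ν i)) T B

/-- The empirical saved regret of a history. -/
def saveHat (ν : F.Inst L) (T : ℕ) {n : ℕ} (h : Hist L n) : ℝ :=
  ∑ i ∈ Finset.univ.filter (fun i => 0 < gap ν i),
    gap ν i * (min (pulls h i : ℝ≥0∞) (cap ν T i)).toReal

/-- The saved regret evaluated at the expected numbers of pulls in the first `n` steps. -/
def saveTilde (ν : F.Inst L) (π : Policy L) (T n : ℕ) : ℝ :=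
  ∑ i ∈ Finset.univ.filter (fun i => 0 < gap ν i),
    gap ν i * (min (cap ν T i) (expPulls ν π n i)).toReal

/-- With horizon `T` and `n` free steps, `π` saves on `ν` at least the fraction `α` of the oracle
saved regret with probability at least `1 - C T ^ (-β)`. -/
def SavesAt (α β C : ℝ) (ν : F.Inst L) (π : Policy L) (T n : ℕ) : Prop :=
  1 - C * (T : ℝ) ^ (-β) ≤
    (histLaw ν π n).real {h | α * saveStar ν T (n : ℝ) ≤ saveHat ν T h}

/-- `(α, β)`-probably saving over the class `Λ`, with budget `g T` at horizon `T`; `π T` is the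
policy used when the horizon is `T`. -/
def IsProbablySaving (α β : ℝ) (g : ℕ → ℕ) (π : ℕ → Policy L) (Λ : Set (F.Inst L)) : Prop :=
  ∀ ν ∈ Λ, ∃ C : ℝ, ∀ᶠ T : ℕ in atTop, SavesAt α β C ν (π T) T (g T)

/-! ### Alternative instances, for an instance sorted by nonincreasing mean
Here `0` is the first item, `⊤` the last one, and `n` is the free budget at horizon `T`. -/

/-- The average saved regret `Δ̄`, defined by `Δ̄ * n = Save*(ν, n)`. -/
def avgSaved (ν : F.Inst L) (T n : ℕ) : ℝ := saveStar ν T (n : ℝ) / n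

/-- The set `L_g` of good items. -/
def goodItems (α : ℝ) (ν : F.Inst L) (T n : ℕ) : Finset (Fin L) :=
  Finset.univ.filter (fun i => gap ν i < avgSaved ν T n - (1 - α) / α * gap ν ⊤)

/-- `ν₁` is a first alternative instance `ν^(1)`, with shift `ε`. -/
def IsAltOne (α : ℝ) (ν : F.Inst L) (T n : ℕ) (ε : ℝ) (ν₁ : F.Inst L) : Prop :=
  0 < ε ∧ (goodItems α ν T n).Nonempty ∧
  (∀ i ∈ goodItems α ν T n,
    F.mean (ν₁ i) = (F.mean (ν 0) + F.mean (ν ⊤) - ε) / 2) ∧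
  (∀ i ∉ goodItems α ν T n,
    F.mean (ν₁ i) = (F.mean (ν 0) + F.mean (ν ⊤) + ε) / 2) ∧
  (∀ i ∈ goodItems α ν T n,
    (n : ℝ≥0∞) < (goodItems α ν T n).card * ENNReal.ofReal (Real.log T)
      / F.kl (ν₁ i) (ν₁ ⊤))

/-- `Δ_S = max_{i ∈ S} Δ_i`. -/
def maxGap (ν : F.Inst L) (S : Finset (Fin L)) : ℝ := sSup (gap ν '' (S : Set (Fin L)))

/-- `i† = min {i | i ∉ S}` (used only when `S` is not everything). -/
def firstOutside (S : Finset (Fin L)) : Fin L :=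
  if h : (Sᶜ).Nonempty then (Sᶜ).min' h else 0

/-- `S ∈ 𝒮_c`: the set `S` of items is a permissible changed set. -/
def IsChangeable (α : ℝ) (ν : F.Inst L) (T n : ℕ) (S : Finset (Fin L)) : Prop :=
  (∀ i ∈ S, i < iFE ν T (n : ℝ)) ∧
  gap ν ⊤ / (gap ν ⊤ + avgSaved ν T n - maxGap ν S) ≤ α ∧
  maxGap ν S < α * avgSaved ν T n ∧
  (n : ℝ≥0∞) < S.card * ENNReal.ofReal (Real.log T) / F.kl (ν ⊤) (ν (firstOutside S))

/-- The permissible shifts `ε` for the changed set `S`: they exceed the threshold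
`ε_S = (1-α) Δ_{i†,L} (Δ_L - Δ_S) / (α (Δ̄ + Δ_L - Δ_S) - Δ_L)` (read as `∞` when the denominator
is not positive), and `|S| ln T / D(ν_ε, ν_{i†}) ≥ n`, where `ν_ε` is the member of the family with
mean `μ_L - ε`. -/
def permissibleShifts (α : ℝ) (ν : F.Inst L) (T n : ℕ) (S : Finset (Fin L)) : Set ℝ :=
  {ε | 0 < α * (avgSaved ν T n + gap ν ⊤ - maxGap ν S) - gap ν ⊤ ∧
    (1 - α) * (F.mean (ν (firstOutside S)) - F.mean (ν ⊤)) * (gap ν ⊤ - maxGap ν S)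
      / (α * (avgSaved ν T n + gap ν ⊤ - maxGap ν S) - gap ν ⊤) < ε ∧
    ∃ θ : F.param, F.mean θ = F.mean (ν ⊤) - ε ∧
      (n : ℝ≥0∞) ≤ S.card * ENNReal.ofReal (Real.log T) / F.kl θ (ν (firstOutside S))}

/-- `ν₂` is the second alternative instance `ν^(2)` for the changed set `S` and shift `ε`. -/
def IsAltTwo (ν : F.Inst L) (S : Finset (Fin L)) (ε : ℝ) (ν₂ : F.Inst L) : Prop :=
  (∀ i ∈ S, F.mean (ν₂ i) = F.mean (ν ⊤) - ε) ∧ (∀ i ∉ S, ν₂ i = ν i)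

/-- The items with labels `c - (j+1)k + 1, …, c - jk` that are at least `1`. Item `i : Fin L` has
label `i + 1`. -/
def block (c k j : ℕ) : Finset (Fin L) :=
  Finset.univ.filter
    (fun i : Fin L => (i : ℕ) + 1 + j * k ≤ c ∧ c < (i : ℕ) + 1 + (j + 1) * k)

/-- The numbers `c`, `k`, `J` that govern the grouping: `c` is the largest label that occurs in a
permissible changed set, `k` is the least size such that the `k` consecutive labels ending at `c`
form a permissible changed set, and the `J` consecutive groups of size `k` going down from `c` all
contain an item. There may also be no group at all (as when no changed set is permissible). -/
def IsGrouping (α : ℝ) (ν : F.Inst L) (T n : ℕ) (c k J : ℕ) : Prop :=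
  J = 0 ∨
  (IsGreatest {l : ℕ | ∃ S, IsChangeable α ν T n S ∧ ∃ i ∈ S, (i : ℕ) + 1 = l} c ∧
    IsLeast {m : ℕ | IsChangeable α ν T n (block c m 0)} k ∧
    (J - 1) * k < c)

/-- `β / max_{i ∈ S} D(ν_i, ν₂_i)`: pulls of `S`, in units of `ln T`, needed to tell `ν₂`
from `ν`. -/
def exploreRate (β : ℝ) (ν ν₂ : F.Inst L) (S : Finset (Fin L)) : ℝ :=
  (ENNReal.ofReal β / S.sup (fun i => F.kl (ν i) (ν₂ i))).toReal

end Saved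

end FreeExploration

end

/-! The oracle saved regret is the value of a fractional knapsack: the budget fills the items from
the worst one upwards, each up to its cap `ln T / D`. Weak duality (`sum_mul_le_greedy`), with the
gap at the threshold item as price of a pull, shows that no feasible allocation does better. It also
shows that the value is Lipschitz in the budget.

An alternative instance is built so that no single history can save well on both instances
(`not_saves_and_saves_altOne`, `not_saves_and_saves_altTwo`): saving on the alternative forces many
pulls of the changed items, and so many of them make saving on `ν` impossible. The saving event of
`ν` is therefore a test that separates the two history laws with errors of order `T ^ (-β)`. The
likelihood ratio of histories involves the rewards only, and its mean logarithm is the sum of the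
expected pulls weighted by divergences (`integral_histLogRatio`), so a good test requires that many
informative pulls.

With too small a budget such a test cannot exist. At a single horizon this is the data-processing
inequality `binary_kl_le_integral` with the numerical bound `log_inv_le_binary_kl`. For unspecified
constants and infinitely many horizons, Bretagnolle-Huber loses a constant factor and gives no
contradiction, since the budget may approach its critical value. What helps is that the one-step
Hellinger affinity strictly exceeds `exp (-D / 2)` (`lt_lintegral_exp_half_llr`); this strict gain,
raised to the power of the diverging budget, beats any constant.

For the second part, Bretagnolle-Huber gives each group at least `r_j ln T - O(1)` expected pulls
(`exists_le_sum_expPulls`). These save at most the largest gap of the group per pull, while the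
remaining pulls form a feasible allocation for the residual knapsack (`saveTilde_le`). Division by
`ln T` removes the bounded error. -/

namespace FreeExploration

/-! ### The greedy allocation -/

section Greedy

variable {L : ℕ} [NeZero L]

/-- The largest `j` such that the capacities of `j, j + 1, …` add up to at least `B`. -/
noncomputable def threshold (c : Fin L → ℝ≥0∞) (B : ℝ) : Fin L :=
  (Finset.univ.filter (fun j : Fin L => ENNReal.ofReal B ≤ ∑ i ∈ Finset.Ici j, c i)).sup id

/-- The value of the greedy allocation of the budget `B` from the last item downwards. -/
noncomputable def greedy (d : Fin L → ℝ) (c : Fin L → ℝ≥0∞) (B : ℝ) : ℝ :=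
  d (threshold c B) * (B - ∑ i ∈ Finset.Ioi (threshold c B), (c i).toReal)
    + ∑ i ∈ Finset.Ioi (threshold c B), d i * (c i).toReal

/-- Otherwise the successor of the threshold would also qualify, against maximality. -/
theorem sum_Ioi_threshold_le (c : Fin L → ℝ≥0∞) (B : ℝ) :
    ∑ i ∈ Finset.Ioi (threshold c B), c i ≤ ENNReal.ofReal B := by
  by_contra! h
  have hne : (Finset.Ioi (threshold c B)).Nonempty := by
    by_contra hne
    rw [Finset.not_nonempty_iff_eq_empty] at hne
    simp [hne] at h
  set m := (Finset.Ioi (threshold c B)).min' hne with hm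
  have hmem : threshold c B < m := Finset.mem_Ioi.1 (Finset.min'_mem _ hne)
  have hsub : Finset.Ioi (threshold c B) ⊆ Finset.Ici m := fun i hi =>
    Finset.mem_Ici.2 (Finset.min'_le _ _ hi)
  have : m ≤ threshold c B := by
    refine Finset.le_sup (f := id) (Finset.mem_filter.2 ⟨Finset.mem_univ _, ?_⟩)
    exact h.le.trans (Finset.sum_le_sum_of_subset hsub)
  exact absurd hmem (not_lt.2 this)

theorem ne_top_of_threshold_lt {c : Fin L → ℝ≥0∞} {B : ℝ} {i : Fin L}
    (hi : threshold c B < i) : c i ≠ ∞ := by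
  have h := sum_Ioi_threshold_le c B
  have h1 := Finset.single_le_sum (f := c) (fun _ _ => zero_le) (Finset.mem_Ioi.2 hi)
  exact ((h1.trans h).trans_lt ENNReal.ofReal_lt_top).ne

theorem sum_toReal_Ioi_threshold_le (c : Fin L → ℝ≥0∞) {B : ℝ} (hB : 0 ≤ B) :
    ∑ i ∈ Finset.Ioi (threshold c B), (c i).toReal ≤ B := by
  rw [← ENNReal.toReal_sum fun i hi => ne_top_of_threshold_lt (Finset.mem_Ioi.1 hi)]
  exact ENNReal.toReal_le_of_le_ofReal hB (sum_Ioi_threshold_le c B)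

/-- The infinite capacity of item `0` makes the set in `threshold` nonempty, so its supremum is
attained. -/
theorem le_sum_Ici_threshold {c : Fin L → ℝ≥0∞} (hc : c 0 = ∞) (B : ℝ) :
    ENNReal.ofReal B ≤ ∑ i ∈ Finset.Ici (threshold c B), c i := by
  have hne : (Finset.univ.filter
      (fun j : Fin L => ENNReal.ofReal B ≤ ∑ i ∈ Finset.Ici j, c i)).Nonempty := by
    refine ⟨0, Finset.mem_filter.2 ⟨Finset.mem_univ _, ?_⟩⟩
    have h1 := Finset.single_le_sum (f := c) (fun _ _ => zero_le)
      (Finset.mem_Ici.2 (le_refl (0 : Fin L)))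
    rw [hc] at h1
    exact le_top.trans h1
  obtain ⟨j, hj, hj'⟩ := Finset.exists_mem_eq_sup _ hne (id : Fin L → Fin L)
  have : threshold c B = j := hj'
  rw [this]
  exact (Finset.mem_filter.1 hj).2

theorem greedy_eq (d : Fin L → ℝ) (c : Fin L → ℝ≥0∞) (B : ℝ) :
    greedy d c B = d (threshold c B) * B +
      ∑ i ∈ Finset.Ioi (threshold c B), (d i - d (threshold c B)) * (c i).toReal := by
  simp only [greedy, sub_mul, Finset.sum_sub_distrib, ← Finset.mul_sum]
  ring

/-- Weak duality for the greedy allocation. -/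
theorem sum_mul_le_greedy {d : Fin L → ℝ} (hd : Monotone d) {c : Fin L → ℝ≥0∞} (B : ℝ)
    {z : Fin L → ℝ} (hz : ∀ i, 0 ≤ z i) (hzc : ∀ i, ENNReal.ofReal (z i) ≤ c i) :
    ∑ i, d i * z i ≤ greedy d c B + d (threshold c B) * (∑ i, z i - B) := by
  rw [greedy_eq]
  set t := threshold c B with ht
  -- With reduced values `d i - d t`, the items up to the threshold contribute at most zero, and the
  -- later ones are best filled to capacity.
  have key : ∑ i, (d i - d t) * z i ≤
      ∑ i ∈ Finset.Ioi t, (d i - d t) * (c i).toReal := by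
    calc ∑ i, (d i - d t) * z i
        ≤ ∑ i, if i ∈ Finset.Ioi t then (d i - d t) * (c i).toReal else 0 := by
          refine Finset.sum_le_sum fun i _ => ?_
          split_ifs with hi
          · rw [Finset.mem_Ioi] at hi
            refine mul_le_mul_of_nonneg_left ?_ (sub_nonneg.2 (hd hi.le))
            exact (ENNReal.ofReal_le_iff_le_toReal (ne_top_of_threshold_lt hi)).1 (hzc i)
          · rw [Finset.mem_Ioi, not_lt] at hi
            exact mul_nonpos_of_nonpos_of_nonneg (sub_nonpos.2 (hd hi)) (hz i)
      _ = _ := by rw [Finset.sum_ite_mem, Finset.univ_inter]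
  simp only [sub_mul _ _ (z _), Finset.sum_sub_distrib, ← Finset.mul_sum] at key
  linarith

/-- The greedy value is attained by a feasible allocation. -/
theorem exists_eq_greedy (d : Fin L → ℝ) {c : Fin L → ℝ≥0∞} (hc : c 0 = ∞) {B : ℝ}
    (hB : 0 ≤ B) :
    ∃ z : Fin L → ℝ, (∀ i, 0 ≤ z i) ∧ (∀ i, ENNReal.ofReal (z i) ≤ c i) ∧ ∑ i, z i = B ∧
      ∑ i, d i * z i = greedy d c B := by
  set t := threshold c B with ht
  set R := B - ∑ i ∈ Finset.Ioi t, (c i).toReal with hR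
  have hR0 : 0 ≤ R := sub_nonneg.2 (sum_toReal_Ioi_threshold_le c hB)
  have hsum : ∀ e : Fin L → ℝ, ∑ i, e i * (if t < i then (c i).toReal else if i = t then R else 0)
      = e t * R + ∑ i ∈ Finset.Ioi t, e i * (c i).toReal := by
    intro e
    have : ∀ i, e i * (if t < i then (c i).toReal else if i = t then R else 0)
        = (if i = t then e i * R else 0) + if i ∈ Finset.Ioi t then e i * (c i).toReal else 0 := by
      intro i
      rcases lt_trichotomy t i with h | h | h
      · simp [h, h.ne']
      · simp [h]
      · simp [h.ne, h.not_gt]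
    simp only [this, Finset.sum_add_distrib, Finset.sum_ite_mem, Finset.univ_inter,
      Finset.sum_ite_eq', Finset.mem_univ, if_true]
  refine ⟨fun i => if t < i then (c i).toReal else if i = t then R else 0, fun i => ?_,
    fun i => ?_, ?_, ?_⟩
  · dsimp only
    split_ifs <;> simp [hR0]
  · dsimp only
    split_ifs with h h'
    · exact ENNReal.ofReal_toReal_le
    · subst h'
      rcases eq_or_ne (c t) ∞ with htop | htop
      · simp [htop]
      · have h1 := le_sum_Ici_threshold hc B
        rw [← ht] at h1
        rw [ENNReal.ofReal_le_iff_le_toReal htop]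
        have h2 : Finset.Ici t = insert t (Finset.Ioi t) := by simp
        rw [h2, Finset.sum_insert (by simp)] at h1
        have hfin : ∑ i ∈ Finset.Ioi t, c i ≠ ∞ :=
          ((sum_Ioi_threshold_le c B).trans_lt ENNReal.ofReal_lt_top).ne
        rw [ENNReal.ofReal_le_iff_le_toReal (ENNReal.add_ne_top.2 ⟨htop, hfin⟩),
          ENNReal.toReal_add htop hfin,
          ENNReal.toReal_sum fun i hi => ne_top_of_threshold_lt (Finset.mem_Ioi.1 hi)] at h1
        rw [hR]
        linarith
    · simp
  · have := hsum (fun _ => 1)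
    simp only [one_mul] at this
    rw [this, hR]
    ring
  · rw [hsum d, greedy]

/-- The dual price at `B` is a supergradient: the optimal allocation for `B'` is tested against it.
-/
theorem greedy_sub_le {d : Fin L → ℝ} (hd : Monotone d) {c : Fin L → ℝ≥0∞} (hc : c 0 = ∞)
    (B : ℝ) {B' : ℝ} (hB' : 0 ≤ B') :
    greedy d c B' - greedy d c B ≤ d (threshold c B) * (B' - B) := by
  obtain ⟨z, h0, h1, h2, h3⟩ := exists_eq_greedy d hc hB'
  have := sum_mul_le_greedy hd B h0 h1
  rw [h2, h3] at this
  linarith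

/-- Negative budgets matter because the residual budget `T'_FE` may be negative; there the greedy
value is linear with slope `d ⊤`. -/
theorem threshold_of_nonpos (c : Fin L → ℝ≥0∞) {B : ℝ} (hB : B ≤ 0) : threshold c B = ⊤ := by
  refine top_le_iff.1 (Finset.le_sup (f := id) (Finset.mem_filter.2 ⟨Finset.mem_univ _, ?_⟩))
  simp [ENNReal.ofReal_of_nonpos hB]

theorem greedy_of_nonpos (d : Fin L → ℝ) (c : Fin L → ℝ≥0∞) {B : ℝ} (hB : B ≤ 0) :
    greedy d c B = d ⊤ * B := by
  simp [greedy, threshold_of_nonpos c hB]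

theorem abs_greedy_sub_le {d : Fin L → ℝ} (hd : Monotone d) (hd0 : ∀ i, 0 ≤ d i)
    {c : Fin L → ℝ≥0∞} (hc : c 0 = ∞) (B B' : ℝ) :
    |greedy d c B' - greedy d c B| ≤ d ⊤ * |B' - B| := by
  have hpos : ∀ {A A' : ℝ}, 0 ≤ A → 0 ≤ A' →
      greedy d c A' - greedy d c A ≤ d ⊤ * |A' - A| := by
    intro A A' _ hA'
    refine (greedy_sub_le hd hc A hA').trans ?_
    exact (mul_le_mul_of_nonneg_left (le_abs_self _) (hd0 _)).trans
      (mul_le_mul_of_nonneg_right (hd le_top) (abs_nonneg _))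
  have habs : ∀ {A A' : ℝ}, 0 ≤ A → 0 ≤ A' →
      |greedy d c A' - greedy d c A| ≤ d ⊤ * |A' - A| := by
    intro A A' hA hA'
    rw [abs_le]
    have h1 := hpos hA hA'
    have h2 := hpos hA' hA
    rw [abs_sub_comm] at h2
    constructor <;> linarith
  have hmix : ∀ {A A' : ℝ}, A ≤ 0 → 0 ≤ A' →
      |greedy d c A' - greedy d c A| ≤ d ⊤ * |A' - A| := by
    intro A A' hA hA'
    have h1 := habs le_rfl hA'
    rw [greedy_of_nonpos d c le_rfl, mul_zero, sub_zero, sub_zero, abs_le,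
      abs_of_nonneg hA'] at h1
    rw [greedy_of_nonpos d c hA, abs_of_nonneg (by linarith : 0 ≤ A' - A), abs_le]
    have := hd0 ⊤
    constructor <;> nlinarith
  rcases le_total 0 B with hB | hB <;> rcases le_total 0 B' with hB' | hB'
  · exact habs hB hB'
  · rw [abs_sub_comm, abs_sub_comm B']
    exact hmix hB' hB
  · exact hmix hB hB'
  · rw [greedy_of_nonpos d c hB, greedy_of_nonpos d c hB', ← mul_sub, abs_mul,
      abs_of_nonneg (hd0 _)]

theorem greedy_smul (d : Fin L → ℝ) (c : Fin L → ℝ≥0∞) (B : ℝ) {s : ℝ} (hs : 0 < s) :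
    greedy d (fun i => ENNReal.ofReal s * c i) (B * s) = greedy d c B * s := by
  have ht : threshold (fun i => ENNReal.ofReal s * c i) (B * s) = threshold c B := by
    unfold threshold
    congr 1
    refine Finset.filter_congr fun j _ => ?_
    rw [mul_comm B, ENNReal.ofReal_mul hs.le, ← Finset.mul_sum,
      ENNReal.mul_le_mul_iff_right (by simpa using hs) ENNReal.ofReal_ne_top]
  simp only [greedy, ht, ENNReal.toReal_mul, ENNReal.toReal_ofReal hs.le, ← Finset.mul_sum]
  rw [add_mul, Finset.sum_mul]
  congr 1
  · ring
  · exact Finset.sum_congr rfl fun i _ => by ring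

end Greedy

/-! ### Gaps, capacities and the oracle saved regret -/

theorem ExpFamily.mean_injective (F : ExpFamily) : Function.Injective F.mean := fun θ θ' h =>
  Subtype.ext (F.mean_injOn θ.2 θ'.2 h)

instance (F : ExpFamily) (θ : F.param) : IsProbabilityMeasure (F.law θ) := by
  have : NeZero F.base := ⟨F.base_ne_zero⟩
  exact isProbabilityMeasure_tilted (F.integrable_exp θ θ.2)

theorem ExpFamily.law_absolutelyContinuous (F : ExpFamily) (θ θ' : F.param) :
    F.law θ ≪ F.law θ' :=
  (tilted_absolutelyContinuous _ _).trans
    (absolutelyContinuous_tilted (F.integrable_exp θ' θ'.2))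

theorem ExpFamily.kl_self (F : ExpFamily) (θ : F.param) : F.kl θ θ = 0 :=
  InformationTheory.klDiv_self _

section Instances

variable {F : ExpFamily} {L : ℕ}

theorem antitone_mean_order (ν : F.Inst L) : Antitone fun i => F.mean (ν (order ν i)) := by
  have h := Tuple.monotone_sort (fun i => -F.mean (ν i))
  exact fun i j hij => neg_le_neg_iff.1 (h hij)

theorem order_eq_refl {ν : F.Inst L} (hν : Antitone fun i => F.mean (ν i)) :
    order ν = Equiv.refl _ :=
  Tuple.sort_eq_refl_iff_monotone.2 fun _ _ hij => neg_le_neg (hν hij)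

theorem sum_pulls {n : ℕ} (h : Hist L n) : ∑ i, pulls h i = n := by
  have := Finset.card_eq_sum_card_fiberwise (f := fun t => (h t).1)
    (s := (Finset.univ : Finset (Fin n))) (t := (Finset.univ : Finset (Fin L)))
    (fun _ _ => Finset.mem_coe.2 (Finset.mem_univ _))
  simpa [pulls] using this.symm

variable [NeZero L]

theorem best_eq_zero {ν : F.Inst L} (hν : Antitone fun i => F.mean (ν i)) : best ν = 0 := by
  simp [best, order_eq_refl hν]

theorem mean_le_mean_best (ν : F.Inst L) (i : Fin L) : F.mean (ν i) ≤ F.mean (ν (best ν)) := by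
  have := antitone_mean_order ν (Fin.zero_le ((order ν).symm i))
  simpa [best] using this

theorem gap_nonneg (ν : F.Inst L) (i : Fin L) : 0 ≤ gap ν i :=
  sub_nonneg.2 (mean_le_mean_best ν i)

theorem monotone_gap {ν : F.Inst L} (hν : Antitone fun i => F.mean (ν i)) : Monotone (gap ν) :=
  fun _ _ hij => sub_le_sub_left (hν hij) _

theorem log_pos_of_two_le {T : ℕ} (hT : 2 ≤ T) : 0 < Real.log T :=
  Real.log_pos (by exact_mod_cast hT)

theorem cap_best (ν : F.Inst L) {T : ℕ} (hT : 2 ≤ T) : cap ν T (best ν) = ∞ := by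
  rw [cap, F.kl_self]
  exact ENNReal.div_zero (by simpa using log_pos_of_two_le hT)

theorem saveStar_eq_greedy (ν : F.Inst L) (T : ℕ) (B : ℝ) :
    saveStar ν T B = greedy (fun i => gap ν (order ν i)) (fun i => cap ν T (order ν i)) B := by
  have hb : best (fun i => ν (order ν i)) = 0 := best_eq_zero (antitone_mean_order ν)
  have h1 : gap (fun i => ν (order ν i)) = fun i => gap ν (order ν i) := by
    funext i; simp only [gap, hb]; rfl
  have h2 : cap (fun i => ν (order ν i)) T = fun i => cap ν T (order ν i) := by
    funext i; simp only [cap, hb]; rfl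
  rw [← h1, ← h2]
  rfl

theorem saveStar_eq_greedy_of_antitone {ν : F.Inst L} (hν : Antitone fun i => F.mean (ν i))
    (T : ℕ) (B : ℝ) : saveStar ν T B = greedy (gap ν) (cap ν T) B := by
  simp [saveStar_eq_greedy, order_eq_refl hν]

/-- Every feasible allocation of the budget saves at most as much as the oracle. -/
theorem sum_gap_mul_le_saveStar (ν : F.Inst L) (T : ℕ) {B : ℝ} {z : Fin L → ℝ}
    (hz : ∀ i, 0 ≤ z i) (hzc : ∀ i, ENNReal.ofReal (z i) ≤ cap ν T i) (hB : ∑ i, z i = B) :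
    ∑ i, gap ν i * z i ≤ saveStar ν T B := by
  have hmono : Monotone fun i => gap ν (order ν i) := fun _ _ hij =>
    sub_le_sub_left (antitone_mean_order ν hij) _
  have h := sum_mul_le_greedy hmono (c := fun i => cap ν T (order ν i)) B
    (z := fun i => z (order ν i)) (fun i => hz _) (fun i => hzc _)
  rw [Equiv.sum_comp (order ν) z, hB, Equiv.sum_comp (order ν) (fun i => gap ν i * z i),
    ← saveStar_eq_greedy] at h
  simpa using h

theorem cap_zero {ν : F.Inst L} (hν : Antitone fun i => F.mean (ν i)) {T : ℕ} (hT : 2 ≤ T) :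
    cap ν T 0 = ∞ := by
  simpa [best_eq_zero hν] using cap_best ν hT

theorem abs_saveStar_sub_le {ν : F.Inst L} (hν : Antitone fun i => F.mean (ν i)) {T : ℕ}
    (hT : 2 ≤ T) (B B' : ℝ) :
    |saveStar ν T B' - saveStar ν T B| ≤ gap ν ⊤ * |B' - B| := by
  simp only [saveStar_eq_greedy_of_antitone hν]
  exact abs_greedy_sub_le (monotone_gap hν) (gap_nonneg ν) (cap_zero hν hT) B B'

theorem saveStar_zero {ν : F.Inst L} (hν : Antitone fun i => F.mean (ν i)) (T : ℕ) :
    saveStar ν T 0 = 0 := by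
  rw [saveStar_eq_greedy_of_antitone hν, greedy_of_nonpos _ _ le_rfl, mul_zero]

theorem abs_saveStar_le {ν : F.Inst L} (hν : Antitone fun i => F.mean (ν i)) {T : ℕ}
    (hT : 2 ≤ T) (B : ℝ) : |saveStar ν T B| ≤ gap ν ⊤ * |B| := by
  simpa [saveStar_zero hν] using abs_saveStar_sub_le hν hT 0 B

theorem avgSaved_le {ν : F.Inst L} (hν : Antitone fun i => F.mean (ν i)) {T n : ℕ}
    (hT : 2 ≤ T) : avgSaved ν T n ≤ gap ν ⊤ := by
  rcases Nat.eq_zero_or_pos n with rfl | hn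
  · simpa [avgSaved] using gap_nonneg ν ⊤
  · have hn' : (0 : ℝ) < n := by exact_mod_cast hn
    rw [avgSaved, div_le_iff₀ hn']
    have := (le_abs_self _).trans (abs_saveStar_le hν hT (n : ℝ))
    rwa [abs_of_pos hn'] at this

/-- At horizons `T ≥ 2` the oracle saved regret is homogeneous in `ln T`. -/
theorem saveStar_mul_log {ν : F.Inst L} (hν : Antitone fun i => F.mean (ν i)) {T : ℕ}
    (hT : 2 ≤ T) (b : ℝ) :
    saveStar ν T (b * Real.log T) =
      greedy (gap ν) (fun i => (F.kl (ν i) (ν 0))⁻¹) b * Real.log T := by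
  rw [saveStar_eq_greedy_of_antitone hν, ← greedy_smul _ _ _ (log_pos_of_two_le hT)]
  congr 1
  funext i
  rw [cap, best_eq_zero hν, div_eq_mul_inv]

/-- The caps are dropped, so that only the number of pulls inside `S` matters. Both disjointness
arguments use it on `ν` and on the alternative. -/
theorem saveHat_le (ν : F.Inst L) (T : ℕ) {n : ℕ} (h : Hist L n) (S : Finset (Fin L)) {a b : ℝ}
    (ha : ∀ i ∈ S, gap ν i ≤ a) (hb : ∀ i ∉ S, gap ν i ≤ b) :
    saveHat ν T h ≤
      a * ∑ i ∈ S, (pulls h i : ℝ) + b * (n - ∑ i ∈ S, (pulls h i : ℝ)) := by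
  have h1 : saveHat ν T h ≤ ∑ i, gap ν i * (pulls h i : ℝ) := by
    unfold saveHat
    refine (Finset.sum_le_sum (g := fun i => gap ν i * (pulls h i : ℝ)) fun i _ => ?_).trans
      (Finset.sum_le_sum_of_subset_of_nonneg (Finset.filter_subset _ _) fun i _ _ =>
        mul_nonneg (gap_nonneg ν i) (Nat.cast_nonneg _))
    refine mul_le_mul_of_nonneg_left ?_ (gap_nonneg ν i)
    have := ENNReal.toReal_mono (ENNReal.natCast_ne_top (pulls h i))
      (min_le_left (pulls h i : ℝ≥0∞) (cap ν T i))
    simpa using this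
  have h2 : (n : ℝ) - ∑ i ∈ S, (pulls h i : ℝ) = ∑ i ∈ Sᶜ, (pulls h i : ℝ) := by
    have := congrArg (Nat.cast (R := ℝ)) (sum_pulls h)
    rw [Nat.cast_sum, ← Finset.sum_add_sum_compl S] at this
    linarith
  refine h1.trans ?_
  rw [h2, ← Finset.sum_add_sum_compl S, Finset.mul_sum, Finset.mul_sum]
  gcongr with i hi i hi
  · exact ha i hi
  · exact hb i (Finset.mem_compl.1 hi)

/-- If the items of `S` have gap `G` and together can absorb the whole budget, the oracle saves
`G` with every free pull. -/
theorem mul_le_saveStar (ν : F.Inst L) (T : ℕ) (n : ℕ) {S : Finset (Fin L)} (hS : S.Nonempty)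
    {G : ℝ} (hG : ∀ i ∈ S, gap ν i = G) {D : ℝ≥0∞} (hD : ∀ i ∈ S, F.kl (ν i) (ν (best ν)) = D)
    (hn : (n : ℝ≥0∞) ≤ S.card * ENNReal.ofReal (Real.log T) / D) :
    G * n ≤ saveStar ν T (n : ℝ) := by
  have hc : (0 : ℝ) < S.card := by exact_mod_cast hS.card_pos
  have hsum : ∀ e : Fin L → ℝ, ∑ i, e i * (if i ∈ S then (n : ℝ) / S.card else 0)
      = (∑ i ∈ S, e i) * ((n : ℝ) / S.card) := fun e => by
    simp only [mul_ite, mul_zero, Finset.sum_ite_mem, Finset.univ_inter, Finset.sum_mul]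
  -- The budget is spread evenly over `S`; `hn` says exactly that each share fits under the common
  -- cap.
  have h := sum_gap_mul_le_saveStar ν T (B := n)
    (z := fun i => if i ∈ S then (n : ℝ) / S.card else 0) (fun i => ?_) (fun i => ?_) ?_
  · rw [hsum, Finset.sum_congr rfl hG, Finset.sum_const, nsmul_eq_mul] at h
    refine le_of_eq_of_le ?_ h
    field_simp
  · split_ifs <;> positivity
  · split_ifs with hi
    · rw [cap, hD i hi, ENNReal.ofReal_div_of_pos hc, ENNReal.ofReal_natCast,
        ENNReal.ofReal_natCast]
      refine ENNReal.div_le_of_le_mul' ?_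
      rwa [← mul_div_assoc]
    · simp
  · have := hsum fun _ => 1
    simp only [one_mul] at this
    rw [this, Finset.sum_const, nsmul_eq_mul, mul_one]
    field_simp

/-! ### The saving events of an instance and of an alternative instance are disjoint -/

/-- The average saved regret never exceeds the largest gap. Hence the last item gets the larger mean
in the first alternative. -/
theorem top_notMem_goodItems {ν : F.Inst L} (hν : Antitone fun i => F.mean (ν i)) {α : ℝ}
    (hα : α ∈ Set.Ioo (0 : ℝ) 1) {T n : ℕ} (hT : 2 ≤ T) : ⊤ ∉ goodItems α ν T n := by
  intro h
  have h1 := (Finset.mem_filter.1 h).2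
  have h2 := avgSaved_le hν hT (n := n)
  have h3 : 0 ≤ (1 - α) / α * gap ν ⊤ :=
    mul_nonneg (div_nonneg (by linarith [hα.2]) hα.1.le) (gap_nonneg ν _)
  linarith

/-- On `ν₁` only good items have a positive gap, and they can absorb the whole budget, so saving
there needs at least `α n` pulls of good items. On `ν` these pulls save too little, by the
definition of `goodItems`, even if all others save the largest gap. -/
theorem not_saves_and_saves_altOne {ν : F.Inst L} (hν : Antitone fun i => F.mean (ν i)) {α : ℝ}
    (hα : α ∈ Set.Ioo (0 : ℝ) 1) {T n : ℕ} (hT : 2 ≤ T) {ε : ℝ} {ν₁ : F.Inst L}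
    (hA : IsAltOne α ν T n ε ν₁) (h : Hist L n) :
    ¬ (α * saveStar ν T (n : ℝ) ≤ saveHat ν T h ∧
      α * saveStar ν₁ T (n : ℝ) ≤ saveHat ν₁ T h) := by
  rintro ⟨h0, h1⟩
  obtain ⟨hε, hne, hin, hout, hcap⟩ := hA
  set S := goodItems α ν T n with hS
  have htop : ⊤ ∉ S := top_notMem_goodItems hν hα hT
  have hbest : best ν₁ ∉ S := fun hb => by
    have := mean_le_mean_best ν₁ ⊤
    rw [hin _ hb, hout _ htop] at this
    linarith
  have hbe : ν₁ (best ν₁) = ν₁ ⊤ := F.mean_injective (by rw [hout _ hbest, hout _ htop])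
  have hgin : ∀ i ∈ S, gap ν₁ i = ε := fun i hi => by
    rw [gap, hout _ hbest, hin _ hi]; ring
  have hgout : ∀ i ∉ S, gap ν₁ i = 0 := fun i hi => by
    rw [gap, hout _ hbest, hout _ hi]; ring
  obtain ⟨i₀, hi₀⟩ := hne
  have hkl : ∀ i ∈ S, F.kl (ν₁ i) (ν₁ (best ν₁)) = F.kl (ν₁ i₀) (ν₁ ⊤) := fun i hi => by
    rw [hbe, F.mean_injective ((hin i hi).trans (hin i₀ hi₀).symm)]
  have hstar := mul_le_saveStar ν₁ T n ⟨i₀, hi₀⟩ hgin hkl (hcap i₀ hi₀).le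
  set t := ∑ i ∈ S, (pulls h i : ℝ) with ht
  have hhat1 := saveHat_le ν₁ T h S (fun i hi => (hgin i hi).le) (fun i hi => (hgout i hi).le)
  rw [← ht, zero_mul, add_zero] at hhat1
  have htα : α * n ≤ t := by
    have : ε * (α * n) ≤ ε * t := by nlinarith [hα.1]
    exact le_of_mul_le_mul_left this hε
  obtain ⟨m, hm, hmax⟩ := S.exists_max_image (gap ν) ⟨i₀, hi₀⟩
  have hhat := saveHat_le ν T h S hmax (fun i _ => monotone_gap hν (le_top : i ≤ ⊤))
  rw [← ht] at hhat
  have hgm : gap ν m < avgSaved ν T n - (1 - α) / α * gap ν ⊤ := (Finset.mem_filter.1 hm).2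
  have hle : gap ν m ≤ gap ν ⊤ := monotone_gap hν le_top
  have hgm' : α * gap ν m + (1 - α) * gap ν ⊤ < α * avgSaved ν T n := by
    have := mul_lt_mul_of_pos_left hgm hα.1
    rw [mul_sub, ← mul_assoc, mul_div_cancel₀ _ hα.1.ne'] at this
    linarith
  -- For `n = 0` the average is `0` by the convention for division, and no item would be good.
  have hn : 0 < n := by
    rcases Nat.eq_zero_or_pos n with h' | h'
    · exfalso
      have e0 : avgSaved ν T n = 0 := by simp [avgSaved, h']
      rw [e0] at hgm'
      have := mul_nonneg hα.1.le (gap_nonneg ν m)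
      have := mul_nonneg (sub_nonneg.2 hα.2.le) (gap_nonneg ν ⊤)
      linarith
    · exact h'
  have hn' : (0 : ℝ) < n := by exact_mod_cast hn
  have havg : saveStar ν T (n : ℝ) = avgSaved ν T n * n := by
    rw [avgSaved, div_mul_cancel₀ _ hn'.ne']
  rw [havg] at h0
  have k1 : (gap ν ⊤ - gap ν m) * (α * n) ≤ (gap ν ⊤ - gap ν m) * t :=
    mul_le_mul_of_nonneg_left htα (sub_nonneg.2 hle)
  have k2 := mul_lt_mul_of_pos_right hgm' hn'
  nlinarith

theorem le_maxGap (ν : F.Inst L) {S : Finset (Fin L)} {i : Fin L} (hi : i ∈ S) :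
    gap ν i ≤ maxGap ν S :=
  le_csSup ((S.finite_toSet.image _).bddAbove) ⟨i, hi, rfl⟩

theorem maxGap_le {ν : F.Inst L} {S : Finset (Fin L)} {a : ℝ} (ha : ∀ i ∈ S, gap ν i ≤ a)
    (ha0 : 0 ≤ a) : maxGap ν S ≤ a := by
  refine Real.sSup_le ?_ ha0
  rintro _ ⟨i, hi, rfl⟩
  exact ha i hi

/-- Let `t` be the number of pulls in `S`. Saving on `ν₂` bounds `t` from below (`k1`), saving on
`ν` bounds it from above (`k2`). Eliminating `t` yields `ε ≤ ε_S`. -/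
theorem not_saves_and_saves_altTwo {ν : F.Inst L} (hν : Antitone fun i => F.mean (ν i)) {α : ℝ}
    (hα : α ∈ Set.Ioo (0 : ℝ) 1) {T n : ℕ} (hn : 0 < n) {S : Finset (Fin L)}
    (hSc : Sᶜ.Nonempty) {ε : ℝ} (hε : ε ∈ permissibleShifts α ν T n S) {ν₂ : F.Inst L}
    (hA : IsAltTwo ν S ε ν₂) (h : Hist L n) :
    ¬ (α * saveStar ν T (n : ℝ) ≤ saveHat ν T h ∧
      α * saveStar ν₂ T (n : ℝ) ≤ saveHat ν₂ T h) := by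
  rintro ⟨h0, h1⟩
  obtain ⟨hden, hεS, θ, hθ, hcap⟩ := hε
  obtain ⟨hin, hout⟩ := hA
  have hn' : (0 : ℝ) < n := by exact_mod_cast hn
  have hSne : S.Nonempty := by
    by_contra hS
    rw [Finset.not_nonempty_iff_eq_empty] at hS
    simp [hS] at hcap
    omega
  set d := firstOutside S with hd
  have hdS : d ∉ S := by
    rw [hd, firstOutside, dif_pos hSc]
    exact Finset.mem_compl.1 (Finset.min'_mem _ hSc)
  have hdmin : ∀ i ∉ S, d ≤ i := fun i hi => by
    rw [hd, firstOutside, dif_pos hSc]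
    exact Finset.min'_le _ _ (Finset.mem_compl.2 hi)
  have hmax : maxGap ν S ≤ gap ν ⊤ :=
    maxGap_le (fun i _ => monotone_gap hν le_top) (gap_nonneg ν _)
  have hdtop : F.mean (ν ⊤) ≤ F.mean (ν d) := hν le_top
  have hε0 : 0 < ε := by
    refine lt_of_le_of_lt (div_nonneg ?_ hden.le) hεS
    exact mul_nonneg (mul_nonneg (by linarith [hα.2]) (by linarith)) (by linarith)
  have hbest : best ν₂ ∉ S := fun hb => by
    have := mean_le_mean_best ν₂ d
    rw [hin _ hb, hout _ hdS] at this
    linarith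
  -- Lowering the means in `S` leaves the first unchanged item of the sorted instance optimal.
  have hbe : ν₂ (best ν₂) = ν d := F.mean_injective <| by
    refine le_antisymm ?_ ?_
    · rw [hout _ hbest]
      exact hν (hdmin _ hbest)
    · rw [← hout _ hdS]
      exact mean_le_mean_best ν₂ d
  set P := F.mean (ν d) - F.mean (ν ⊤) with hP
  have hgin : ∀ i ∈ S, gap ν₂ i = P + ε := fun i hi => by
    rw [gap, hbe, hin _ hi]; ring
  have hgout : ∀ i ∉ S, gap ν₂ i ≤ P := fun i hi => by
    rw [gap, hbe, hout _ hi]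
    exact sub_le_sub_left (hν le_top) _
  have hkl : ∀ i ∈ S, F.kl (ν₂ i) (ν₂ (best ν₂)) = F.kl θ (ν d) := fun i hi => by
    rw [hbe, F.mean_injective ((hin i hi).trans hθ.symm)]
  have hstar := mul_le_saveStar ν₂ T n hSne hgin hkl hcap
  set t := ∑ i ∈ S, (pulls h i : ℝ) with ht
  have hhat1 := saveHat_le ν₂ T h S (fun i hi => (hgin i hi).le) hgout
  have hhat := saveHat_le ν T h S (fun i hi => le_maxGap ν hi)
    (fun i _ => monotone_gap hν (le_top : i ≤ ⊤))
  rw [← ht] at hhat hhat1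
  have havg : saveStar ν T (n : ℝ) = avgSaved ν T n * n := by
    rw [avgSaved, div_mul_cancel₀ _ hn'.ne']
  rw [havg] at h0
  rw [div_lt_iff₀ hden] at hεS
  have k1 : (α * (P + ε) - P) * n ≤ ε * t := by nlinarith [hα.1]
  have k2 : (gap ν ⊤ - maxGap ν S) * t ≤ (gap ν ⊤ - α * avgSaved ν T n) * n := by linarith
  have k3 := mul_le_mul_of_nonneg_left k1 (sub_nonneg.2 hmax)
  have k4 := mul_le_mul_of_nonneg_left k2 hε0.le
  have k5 := mul_lt_mul_of_pos_right hεS hn'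
  nlinarith

end Instances

/-! ### The law of the history -/

section History

variable {F : ExpFamily} {L : ℕ}

instance (ν : F.Inst L) : IsMarkovKernel (rewardKernel ν) :=
  ⟨fun i => inferInstanceAs (IsProbabilityMeasure (F.law (ν i)))⟩

instance (ν : F.Inst L) (π : Policy L) (n : ℕ) : IsMarkovKernel (stepKernel ν π n) := by
  have := π.markov n
  unfold stepKernel
  infer_instance

theorem measurable_snoc (n : ℕ) :
    Measurable fun p : Hist L n × (Fin L × ℝ) => (Fin.snoc p.1 p.2 : Hist L (n + 1)) := by
  refine measurable_pi_iff.2 fun t => ?_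
  refine Fin.lastCases ?_ (fun i => ?_) t
  · simpa using measurable_snd
  · simp only [Fin.snoc_castSucc]
    fun_prop

instance (ν : F.Inst L) (π : Policy L) (n : ℕ) : IsProbabilityMeasure (histLaw ν π n) := by
  induction n with
  | zero => unfold histLaw; infer_instance
  | succ n ih =>
    unfold histLaw
    exact Measure.isProbabilityMeasure_map (measurable_snoc n).aemeasurable

theorem lintegral_stepKernel (ν : F.Inst L) (π : Policy L) {n : ℕ} (h : Hist L n)
    {f : Fin L × ℝ → ℝ≥0∞} (hf : Measurable f) :
    ∫⁻ p, f p ∂(stepKernel ν π n h) =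
      ∑ i, (∫⁻ x, f (i, x) ∂(F.law (ν i))) * π.rule n h {i} := by
  have := π.markov n
  rw [stepKernel, Kernel.lintegral_compProd _ _ _ hf, lintegral_fintype]
  rfl

theorem lintegral_histLaw_succ (ν : F.Inst L) (π : Policy L) (n : ℕ)
    {f : Hist L (n + 1) → ℝ≥0∞} (hf : Measurable f) :
    ∫⁻ h, f h ∂(histLaw ν π (n + 1)) =
      ∫⁻ h, ∫⁻ p, f (Fin.snoc h p : Hist L (n + 1)) ∂(stepKernel ν π n h) ∂(histLaw ν π n) := by
  have hfs : Measurable fun p : Hist L n × (Fin L × ℝ) =>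
    f (Fin.snoc p.1 p.2 : Hist L (n + 1)) := hf.comp (measurable_snoc n)
  rw [histLaw, lintegral_map hf (measurable_snoc n), Measure.lintegral_compProd hfs]

/-- Whatever item the policy draws, the next factor has conditional mean at least `ρ`, so the bounds
multiply along the history. -/
theorem lintegral_prod_le (ν : F.Inst L) (π : Policy L) {φ : Fin L × ℝ → ℝ≥0∞}
    (hφ : Measurable φ) {ρ : ℝ≥0∞} (hρ : ∀ i, ρ ≤ ∫⁻ x, φ (i, x) ∂(F.law (ν i))) (n : ℕ) :
    ρ ^ n ≤ ∫⁻ h : Hist L n, ∏ t, φ (h t) ∂(histLaw ν π n) := by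
  induction n with
  | zero => simp
  | succ n ih =>
    rw [lintegral_histLaw_succ _ _ _ (by fun_prop)]
    simp only [Fin.prod_univ_castSucc, Fin.snoc_castSucc, Fin.snoc_last]
    calc ρ ^ (n + 1) ≤ (∫⁻ h : Hist L n, ∏ t, φ (h t) ∂(histLaw ν π n)) * ρ := by
          rw [pow_succ]; gcongr
      _ = ∫⁻ h : Hist L n, (∏ t, φ (h t)) * ρ ∂(histLaw ν π n) :=
          (lintegral_mul_const _ (by fun_prop)).symm
      _ ≤ _ := by
          refine lintegral_mono fun h => ?_
          rw [lintegral_const_mul _ hφ]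
          gcongr
          have := π.markov n
          rw [lintegral_stepKernel _ _ _ hφ]
          calc ρ = ∑ i, ρ * π.rule n h {i} := by
                rw [← Finset.mul_sum, sum_measure_singleton, Finset.coe_univ, measure_univ,
                  mul_one]
            _ ≤ _ := by gcongr with i; exact hρ i

theorem pulls_eq_sum {n : ℕ} (h : Hist L n) (i : Fin L) :
    (pulls h i : ℝ≥0∞) = ∑ t, if (h t).1 = i then 1 else 0 := by
  simp [pulls]

theorem measurable_fst_eq (i : Fin L) :
    Measurable fun p : Fin L × ℝ => if p.1 = i then (1 : ℝ≥0∞) else 0 :=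
  (measurable_of_countable fun j : Fin L => if j = i then (1 : ℝ≥0∞) else 0).comp measurable_fst

theorem lintegral_sum_eq (ν : F.Inst L) (π : Policy L) (n : ℕ) {φ : Fin L × ℝ → ℝ≥0∞}
    (hφ : Measurable φ) :
    ∫⁻ h : Hist L n, ∑ t, φ (h t) ∂(histLaw ν π n) =
      ∑ i, (∫⁻ x, φ (i, x) ∂(F.law (ν i))) * expPulls ν π n i := by
  -- The weights are left unspecified during the induction; testing with the indicator of one item
  -- then identifies them as `expPulls`.
  have key : ∃ N : Fin L → ℝ≥0∞, ∀ φ : Fin L × ℝ → ℝ≥0∞, Measurable φ →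
      ∫⁻ h : Hist L n, ∑ t, φ (h t) ∂(histLaw ν π n) =
        ∑ i, (∫⁻ x, φ (i, x) ∂(F.law (ν i))) * N i := by
    induction n with
    | zero => exact ⟨0, fun φ _ => by simp⟩
    | succ n ih =>
      obtain ⟨N, hN⟩ := ih
      refine ⟨fun i => N i + ∫⁻ h, π.rule n h {i} ∂(histLaw ν π n), fun φ hφ => ?_⟩
      rw [lintegral_histLaw_succ _ _ _ (by fun_prop)]
      simp only [Fin.sum_univ_castSucc, Fin.snoc_castSucc, Fin.snoc_last]
      have h1 : ∀ h : Hist L n, ∫⁻ p, (∑ t, φ (h t) + φ p) ∂(stepKernel ν π n h) =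
          ∑ t, φ (h t) + ∑ i, (∫⁻ x, φ (i, x) ∂(F.law (ν i))) * π.rule n h {i} := fun h => by
        rw [lintegral_add_left measurable_const, lintegral_const, measure_univ, mul_one,
          lintegral_stepKernel _ _ _ hφ]
      have hm : ∀ i : Fin L, Measurable fun h : Hist L n => π.rule n h {i} := fun i =>
        Kernel.measurable_coe _ (measurableSet_singleton i)
      simp only [h1]
      rw [lintegral_add_left (by fun_prop), hN φ hφ,
        lintegral_finsetSum _ fun i _ => (hm i).const_mul _]
      simp only [lintegral_const_mul _ (hm _), mul_add, Finset.sum_add_distrib]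
  obtain ⟨N, hN⟩ := key
  have hN' : ∀ i, expPulls ν π n i = N i := fun i => by
    simp only [expPulls, pulls_eq_sum]
    have h1 : ∀ j, ∫⁻ _, (if j = i then (1 : ℝ≥0∞) else 0) ∂(F.law (ν j)) =
        if j = i then 1 else 0 := fun j => by simp
    rw [hN _ (measurable_fst_eq i)]
    simp only [h1]
    simp
  simp only [hN, hφ, hN']

theorem sum_expPulls (ν : F.Inst L) (π : Policy L) (n : ℕ) :
    ∑ i, expPulls ν π n i = n := by
  have := lintegral_sum_eq ν π n (φ := fun _ => 1) measurable_const
  simpa using this.symm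

theorem expPulls_ne_top (ν : F.Inst L) (π : Policy L) (n : ℕ) (i : Fin L) :
    expPulls ν π n i ≠ ∞ := by
  have h := Finset.single_le_sum (f := expPulls ν π n) (fun _ _ => zero_le) (Finset.mem_univ i)
  rw [sum_expPulls] at h
  exact (h.trans_lt (ENNReal.natCast_lt_top n)).ne

theorem sum_toReal_expPulls (ν : F.Inst L) (π : Policy L) (n : ℕ) :
    ∑ i, (expPulls ν π n i).toReal = n := by
  rw [← ENNReal.toReal_sum fun i _ => expPulls_ne_top ν π n i, sum_expPulls,
    ENNReal.toReal_natCast]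

/-! ### Change of measure -/

/-- The log-likelihood ratio of an observed (item, reward) pair. -/
noncomputable def logRatio (ν ν' : F.Inst L) (p : Fin L × ℝ) : ℝ :=
  llr (F.law (ν p.1)) (F.law (ν' p.1)) p.2

theorem measurable_logRatio (ν ν' : F.Inst L) : Measurable (logRatio ν ν') :=
  
  measurable_from_prod_countable_right fun i =>
    (measurable_llr (F.law (ν i)) (F.law (ν' i)) :)

/-- The log-likelihood ratio of a history. -/
noncomputable def histLogRatio (ν ν' : F.Inst L) {n : ℕ} (h : Hist L n) : ℝ :=
  ∑ t, logRatio ν ν' (h t)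

theorem measurable_histLogRatio (ν ν' : F.Inst L) (n : ℕ) :
    Measurable (histLogRatio ν ν' : Hist L n → ℝ) := by
  have := measurable_logRatio ν ν'
  unfold histLogRatio
  fun_prop

theorem law_eq_withDensity (θ θ' : F.param) :
    F.law θ' = (F.law θ).withDensity
      fun x => ENNReal.ofReal (Real.exp (-llr (F.law θ) (F.law θ') x)) := by
  have h := exp_neg_llr (F.law_absolutelyContinuous θ θ')
  conv_lhs => rw [← Measure.withDensity_rnDeriv_eq _ _ (F.law_absolutelyContinuous θ' θ)]
  refine withDensity_congr_ae ?_
  filter_upwards [h, (F.law θ').rnDeriv_lt_top (F.law θ)] with x hx hx'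
  have : Real.exp (-llr (F.law θ) (F.law θ') x) = ((F.law θ').rnDeriv (F.law θ) x).toReal := hx
  rw [this, ENNReal.ofReal_toReal hx'.ne]

theorem lintegral_law_eq (θ θ' : F.param) {f : ℝ → ℝ≥0∞} (hf : Measurable f) :
    ∫⁻ x, f x ∂(F.law θ') =
      ∫⁻ x, f x * ENNReal.ofReal (Real.exp (-llr (F.law θ) (F.law θ') x)) ∂(F.law θ) := by
  have hm := measurable_llr (F.law θ) (F.law θ')
  conv_lhs => rw [law_eq_withDensity θ θ']
  rw [lintegral_withDensity_eq_lintegral_mul _ (by fun_prop) hf]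
  simp only [Pi.mul_apply, mul_comm]

/-- The same policy runs on both instances, so its item probabilities cancel and only reward
densities remain. -/
theorem lintegral_histLaw_eq (ν ν' : F.Inst L) (π : Policy L) (n : ℕ)
    {f : Hist L n → ℝ≥0∞} (hf : Measurable f) :
    ∫⁻ h, f h ∂(histLaw ν' π n) =
      ∫⁻ h, f h * ENNReal.ofReal (Real.exp (-histLogRatio ν ν' h)) ∂(histLaw ν π n) := by
  induction n with
  | zero => simp [histLaw, histLogRatio]
  | succ n ih =>
    have hm := measurable_histLogRatio ν ν' n
    have hm' := measurable_histLogRatio ν ν' (n + 1)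
    have hl := measurable_logRatio ν ν'
    have hfs : Measurable fun p : Hist L n × (Fin L × ℝ) =>
      f (Fin.snoc p.1 p.2 : Hist L (n + 1)) := hf.comp (measurable_snoc n)
    rw [lintegral_histLaw_succ _ _ _ hf, lintegral_histLaw_succ _ _ _ (by fun_prop),
      ih (Measurable.lintegral_kernel_prod_right' hfs)]
    refine lintegral_congr fun h => ?_
    have hfh : Measurable fun p : Fin L × ℝ => f (Fin.snoc h p : Hist L (n + 1)) :=
      hfs.comp measurable_prodMk_left
    have hsplit : ∀ p : Fin L × ℝ,
        f (Fin.snoc h p : Hist L (n + 1)) * ENNReal.ofReal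
            (Real.exp (-histLogRatio ν ν' (Fin.snoc h p : Hist L (n + 1)))) =
          f (Fin.snoc h p : Hist L (n + 1)) * ENNReal.ofReal (Real.exp (-logRatio ν ν' p)) *
            ENNReal.ofReal (Real.exp (-histLogRatio ν ν' h)) := fun p => by
      rw [mul_assoc, ← ENNReal.ofReal_mul (Real.exp_pos _).le, ← Real.exp_add]
      simp only [histLogRatio, Fin.sum_univ_castSucc, Fin.snoc_castSucc, Fin.snoc_last]
      congr 3
      ring
    simp only [hsplit]
    rw [lintegral_mul_const _ (by fun_prop), lintegral_stepKernel _ _ _ hfh,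
      lintegral_stepKernel _ _ _ (by fun_prop)]
    congr 1
    refine Finset.sum_congr rfl fun i _ => ?_
    have hfi : Measurable fun x : ℝ => f (Fin.snoc h (i, x) : Hist L (n + 1)) :=
      hfh.comp measurable_prodMk_left
    rw [lintegral_law_eq (ν i) (ν' i) hfi]
    rfl

theorem histLaw_eq_withDensity (ν ν' : F.Inst L) (π : Policy L) (n : ℕ) :
    histLaw ν' π n = (histLaw ν π n).withDensity
      fun h => ENNReal.ofReal (Real.exp (-histLogRatio ν ν' h)) := by
  ext s hs
  rw [withDensity_apply _ hs, ← lintegral_indicator hs, ← lintegral_indicator_one hs,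
    lintegral_histLaw_eq ν ν' π n (measurable_one.indicator hs)]
  refine lintegral_congr fun h => ?_
  by_cases hh : h ∈ s <;> simp [hh]

/-- The occupation measure of the (item, reward) pairs. It yields both the integrability of every
one-step log-ratio and the divergence decomposition. -/
theorem sum_map_histLaw (ν : F.Inst L) (π : Policy L) (n : ℕ) :
    ∑ t : Fin n, (histLaw ν π n).map (fun h => h t) =
      ∑ i, expPulls ν π n i • (F.law (ν i)).map (Prod.mk i) := by
  ext s hs
  have h1 := lintegral_sum_eq ν π n (φ := s.indicator 1) (measurable_one.indicator hs)
  have hm : ∀ t : Fin n, Measurable fun h : Hist L n => s.indicator (1 : Fin L × ℝ → ℝ≥0∞) (h t) :=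
    fun t => (measurable_one.indicator hs).comp (measurable_pi_apply t)
  rw [lintegral_finsetSum _ fun t _ => hm t] at h1
  simp only [Measure.coe_finsetSum, Finset.sum_apply, Measure.smul_apply, smul_eq_mul]
  convert h1 using 2 with t _ i _
  · rw [← lintegral_indicator_one hs,
      lintegral_map (measurable_one.indicator hs) (measurable_pi_apply t)]
  · rw [mul_comm, ← lintegral_indicator_one hs,
      lintegral_map (measurable_one.indicator hs) measurable_prodMk_left]

theorem integrable_llr_of_kl_ne_top {θ θ' : F.param} (h : F.kl θ θ' ≠ ∞) :
    Integrable (llr (F.law θ) (F.law θ')) (F.law θ) :=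
  (InformationTheory.klDiv_ne_top_iff.1 h).2

theorem integral_llr_law (θ θ' : F.param) :
    ∫ x, llr (F.law θ) (F.law θ') x ∂(F.law θ) = (F.kl θ θ').toReal := by
  rw [ExpFamily.kl, InformationTheory.toReal_klDiv_of_measure_eq
    (F.law_absolutelyContinuous θ θ') (by simp)]

theorem integrable_logRatio_map {ν ν' : F.Inst L} {i : Fin L} (h : F.kl (ν i) (ν' i) ≠ ∞) :
    Integrable (logRatio ν ν') ((F.law (ν i)).map (Prod.mk i)) := by
  rw [integrable_map_measure (measurable_logRatio ν ν').aestronglyMeasurable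
    measurable_prodMk_left.aemeasurable]
  exact (integrable_llr_of_kl_ne_top h).congr (Eventually.of_forall fun _ => rfl)

theorem integral_logRatio_map (ν ν' : F.Inst L) (i : Fin L) :
    ∫ p, logRatio ν ν' p ∂((F.law (ν i)).map (Prod.mk i)) = (F.kl (ν i) (ν' i)).toReal := by
  rw [integral_map measurable_prodMk_left.aemeasurable
    (measurable_logRatio ν ν').aestronglyMeasurable, ← integral_llr_law]
  rfl

theorem integrable_logRatio_sum {ν ν' : F.Inst L} (π : Policy L) (n : ℕ)
    (hkl : ∀ i, F.kl (ν i) (ν' i) ≠ ∞) (t : Fin n) :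
    Integrable (logRatio ν ν') ((histLaw ν π n).map (fun h => h t)) := by
  have hM : Integrable (logRatio ν ν') (∑ t : Fin n, (histLaw ν π n).map (fun h => h t)) := by
    rw [sum_map_histLaw, integrable_finsetSum_measure]
    intro i _
    exact (integrable_logRatio_map (hkl i)).smul_measure (expPulls_ne_top ν π n i)
  exact integrable_finsetSum_measure.1 hM t (Finset.mem_univ t)

theorem integrable_logRatio_apply {ν ν' : F.Inst L} (π : Policy L) {n : ℕ}
    (hkl : ∀ i, F.kl (ν i) (ν' i) ≠ ∞) (t : Fin n) :
    Integrable (fun h : Hist L n => logRatio ν ν' (h t)) (histLaw ν π n) := by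
  have h := integrable_logRatio_sum π n hkl t
  rwa [integrable_map_measure (measurable_logRatio ν ν').aestronglyMeasurable
    (measurable_pi_apply t).aemeasurable] at h

theorem integrable_histLogRatio {ν ν' : F.Inst L} (π : Policy L) (n : ℕ)
    (hkl : ∀ i, F.kl (ν i) (ν' i) ≠ ∞) :
    Integrable (histLogRatio ν ν') (histLaw ν π n) :=
  integrable_finsetSum _ fun t _ => integrable_logRatio_apply π hkl t

/-- The divergence decomposition. -/
theorem integral_histLogRatio {ν ν' : F.Inst L} (π : Policy L) (n : ℕ)
    (hkl : ∀ i, F.kl (ν i) (ν' i) ≠ ∞) :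
    ∫ h, histLogRatio ν ν' h ∂(histLaw ν π n) =
      ∑ i, (expPulls ν π n i).toReal * (F.kl (ν i) (ν' i)).toReal := by
  have e1 : ∫ h, histLogRatio ν ν' h ∂(histLaw ν π n) =
      ∫ p, logRatio ν ν' p ∂(∑ t : Fin n, (histLaw ν π n).map (fun h => h t)) := by
    rw [integral_finsetSum_measure fun t _ => integrable_logRatio_sum π n hkl t]
    unfold histLogRatio
    rw [integral_finsetSum _ fun t _ => integrable_logRatio_apply π hkl t]
    refine Finset.sum_congr rfl fun t _ => ?_
    rw [integral_map (measurable_pi_apply t).aemeasurable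
      (measurable_logRatio ν ν').aestronglyMeasurable]
  rw [e1, sum_map_histLaw, integral_finsetSum_measure fun i _ =>
    (integrable_logRatio_map (hkl i)).smul_measure (expPulls_ne_top ν π n i)]
  refine Finset.sum_congr rfl fun i _ => ?_
  rw [integral_smul_measure, smul_eq_mul, integral_logRatio_map]

theorem measurableSet_le_saveHat [NeZero L] (ν : F.Inst L) (T n : ℕ) (a : ℝ) :
    MeasurableSet {h : Hist L n | a ≤ saveHat ν T h} := by
  have h1 : ∀ i, Measurable fun h : Hist L n => (pulls h i : ℝ≥0∞) := fun i => by
    simp only [pulls_eq_sum]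
    have := measurable_fst_eq i
    exact Finset.measurable_sum _ fun t _ => this.comp (measurable_pi_apply t)
  have h2 : Measurable fun h : Hist L n => saveHat ν T h :=
    Finset.measurable_sum _ fun i _ =>
      (((h1 i).min measurable_const).ennreal_toReal).const_mul _
  exact measurableSet_le measurable_const h2

end History

/-! ### Information inequalities -/

section Information

variable {Ω : Type*} [MeasurableSpace Ω] {μ μ' : Measure Ω}

theorem ofReal_exp_integral_le [IsProbabilityMeasure μ] {Y : Ω → ℝ} (hY : Integrable Y μ) :
    ENNReal.ofReal (Real.exp (∫ ω, Y ω ∂μ)) ≤ ∫⁻ ω, ENNReal.ofReal (Real.exp (Y ω)) ∂μ := by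
  have hpos : 0 ≤ᵐ[μ] fun ω => Real.exp (Y ω) := Eventually.of_forall fun ω => (Real.exp_pos _).le
  by_cases hi : Integrable (fun ω => Real.exp (Y ω)) μ
  · rw [← ofReal_integral_eq_lintegral_ofReal hi hpos]
    exact ENNReal.ofReal_le_ofReal <| convexOn_exp.map_integral_le Real.continuous_exp.continuousOn
      isClosed_univ (Eventually.of_forall fun _ => Set.mem_univ _) hY hi
  · have := (lintegral_ofReal_ne_top_iff_integrable
      (Real.continuous_exp.comp_aestronglyMeasurable hY.1) hpos).not.2 hi
    rw [not_not] at this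
    exact this.symm ▸ le_top

/-- The equality case of Jensen, from strict convexity of the exponential. -/
theorem ae_eq_of_lintegral_exp_le [IsProbabilityMeasure μ] {Y : Ω → ℝ} (hY : Integrable Y μ)
    (h : ∫⁻ ω, ENNReal.ofReal (Real.exp (Y ω)) ∂μ ≤ ENNReal.ofReal (Real.exp (∫ ω, Y ω ∂μ))) :
    Y =ᵐ[μ] fun _ => ∫ ω, Y ω ∂μ := by
  have hpos : 0 ≤ᵐ[μ] fun ω => Real.exp (Y ω) := Eventually.of_forall fun ω => (Real.exp_pos _).le
  have hi : Integrable (fun ω => Real.exp (Y ω)) μ :=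
    (lintegral_ofReal_ne_top_iff_integrable
      (Real.continuous_exp.comp_aestronglyMeasurable hY.1) hpos).1
      (h.trans_lt ENNReal.ofReal_lt_top).ne
  rw [← ofReal_integral_eq_lintegral_ofReal hi hpos,
    ENNReal.ofReal_le_ofReal_iff (Real.exp_pos _).le] at h
  rcases strictConvexOn_exp.ae_eq_const_or_map_average_lt Real.continuous_exp.continuousOn
    isClosed_univ (Eventually.of_forall fun _ => Set.mem_univ _) hY hi with h' | h'
  · rw [average_eq_integral] at h'
    exact h'
  · simp only [average_eq_integral] at h'
    exact absurd h' (not_lt.2 h)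

variable {X : Ω → ℝ}

/-- Cauchy-Schwarz on `E`: the square of the integrand is the density of `μ'`. -/
theorem setLIntegral_exp_half_le (hX : Measurable X)
    (hμ' : μ' = μ.withDensity fun ω => ENNReal.ofReal (Real.exp (-X ω))) {E : Set Ω}
    (hE : MeasurableSet E) :
    ∫⁻ ω in E, ENNReal.ofReal (Real.exp (-X ω / 2)) ∂μ ≤
      μ' E ^ (1 / 2 : ℝ) * μ E ^ (1 / 2 : ℝ) := by
  have h := ENNReal.lintegral_mul_le_Lp_mul_Lq (μ.restrict E) Real.HolderConjugate.two_two
    (f := fun ω => ENNReal.ofReal (Real.exp (-X ω / 2))) (g := fun _ => 1)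
    (by fun_prop) (by fun_prop)
  have hsq : ∀ ω, ENNReal.ofReal (Real.exp (-X ω / 2)) ^ (2 : ℝ) =
      ENNReal.ofReal (Real.exp (-X ω)) := fun ω => by
    rw [ENNReal.ofReal_rpow_of_pos (Real.exp_pos _), ← Real.exp_mul]
    congr 2
    ring
  simp only [Pi.mul_apply, mul_one, hsq, ENNReal.one_rpow, lintegral_one,
    Measure.restrict_apply_univ] at h
  rw [hμ', withDensity_apply _ hE]
  exact h

/-- The Hellinger affinity is small if some event separates the two laws. -/
theorem lintegral_exp_half_le [IsProbabilityMeasure μ] [IsProbabilityMeasure μ']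
    (hX : Measurable X)
    (hμ' : μ' = μ.withDensity fun ω => ENNReal.ofReal (Real.exp (-X ω))) {E : Set Ω}
    (hE : MeasurableSet E) {p q : ℝ} (hp : μ.real Eᶜ ≤ p) (hq : μ'.real E ≤ q) :
    ∫⁻ ω, ENNReal.ofReal (Real.exp (-X ω / 2)) ∂μ ≤ ENNReal.ofReal (√q + √p) := by
  have hsqrt : ∀ {m : Measure Ω} [IsProbabilityMeasure m] {A : Set Ω} {r : ℝ}, m.real A ≤ r →
      m A ^ (1 / 2 : ℝ) ≤ ENNReal.ofReal √r := by
    intro m _ A r hr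
    have h0 : 0 ≤ r := measureReal_nonneg.trans hr
    rw [Real.sqrt_eq_rpow, ← ENNReal.ofReal_rpow_of_nonneg h0 (by norm_num)]
    refine ENNReal.rpow_le_rpow ?_ (by norm_num)
    rw [← ofReal_measureReal]
    exact ENNReal.ofReal_le_ofReal hr
  have hone : ∀ {m : Measure Ω} [IsProbabilityMeasure m] {A : Set Ω}, m A ^ (1 / 2 : ℝ) ≤ 1 :=
    fun {m _ A} => ENNReal.rpow_le_one prob_le_one (by norm_num)
  rw [← lintegral_add_compl _ hE, ENNReal.ofReal_add (Real.sqrt_nonneg _) (Real.sqrt_nonneg _)]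
  refine add_le_add ((setLIntegral_exp_half_le hX hμ' hE).trans ?_)
    ((setLIntegral_exp_half_le hX hμ' hE.compl).trans ?_)
  · exact (mul_le_mul' (hsqrt hq) hone).trans_eq (mul_one _)
  · exact (mul_le_mul' hone (hsqrt hp)).trans_eq (one_mul _)

/-- The Bretagnolle-Huber inequality. -/
theorem exp_neg_half_integral_le [IsProbabilityMeasure μ] [IsProbabilityMeasure μ']
    (hX : Measurable X) (hXi : Integrable X μ)
    (hμ' : μ' = μ.withDensity fun ω => ENNReal.ofReal (Real.exp (-X ω))) {E : Set Ω}
    (hE : MeasurableSet E) {p q : ℝ} (hp : μ.real Eᶜ ≤ p) (hq : μ'.real E ≤ q) :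
    Real.exp (-(∫ ω, X ω ∂μ) / 2) ≤ √q + √p := by
  have h := (ofReal_exp_integral_le (hXi.neg.div_const 2)).trans
    (lintegral_exp_half_le hX hμ' hE hp hq)
  rw [ENNReal.ofReal_le_ofReal_iff (by positivity)] at h
  simpa [integral_div, integral_neg] using h

/-- Data processing for an event of probability at least `1 - δ` under the first law and at most
`δ` under the second one. -/
theorem binary_kl_le_integral [IsProbabilityMeasure μ] [IsProbabilityMeasure μ']
    (hX : Measurable X) (hXi : Integrable X μ)
    (hμ' : μ' = μ.withDensity fun ω => ENNReal.ofReal (Real.exp (-X ω))) {E : Set Ω}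
    (hE : MeasurableSet E) {δ : ℝ} (hδ0 : 0 < δ) (hδ : δ ≤ 1 / 2) (hp : μ.real Eᶜ ≤ δ)
    (hq : μ'.real E ≤ δ) :
    (1 - 2 * δ) * Real.log ((1 - δ) / δ) ≤ ∫ ω, X ω ∂μ := by
  have hratio : 1 ≤ (1 - δ) / δ := by rw [le_div_iff₀ hδ0]; linarith
  set a := Real.log ((1 - δ) / δ) with ha
  have ha0 : 0 ≤ a := Real.log_nonneg hratio
  have hea : Real.exp a = (1 - δ) / δ := Real.exp_log (by linarith)
  have hea' : Real.exp (-a) = δ / (1 - δ) := by rw [Real.exp_neg, hea, inv_div]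
  have hf1 : Integrable (E.indicator fun _ => a) μ := (integrable_const a).indicator hE
  have hf2 : Integrable (Eᶜ.indicator fun _ => -a) μ := (integrable_const (-a)).indicator hE.compl
  -- Donsker-Varadhan with the test function `a` on `E` and `-a` off `E`. The choice of `a` gives
  -- `exp a * δ + exp (-a) * (1 - δ) = 1`, so the exponential moment is at most one.
  have hJ := ofReal_exp_integral_le ((hf1.add hf2).sub hXi)
  have hexp : ∀ ω, ENNReal.ofReal
      (Real.exp (((E.indicator (fun _ => a) + Eᶜ.indicator fun _ => -a) - X) ω)) =
      ENNReal.ofReal (Real.exp (-X ω)) * (E.indicator (fun _ => ENNReal.ofReal (Real.exp a)) ω +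
        Eᶜ.indicator (fun _ => ENNReal.ofReal (Real.exp (-a))) ω) := fun ω => by
    by_cases hω : ω ∈ E <;>
    · simp only [Pi.sub_apply, Pi.add_apply, hω, Set.indicator_of_mem, Set.mem_compl_iff,
        not_true_eq_false, not_false_eq_true, Set.indicator_of_notMem, add_zero, zero_add,
        ← ENNReal.ofReal_mul (Real.exp_pos _).le, ← Real.exp_add]
      congr 2
      ring
  have hm1 : Measurable (E.indicator fun _ => ENNReal.ofReal (Real.exp a)) :=
    measurable_const.indicator hE
  have hm2 : Measurable (Eᶜ.indicator fun _ => ENNReal.ofReal (Real.exp (-a))) :=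
    measurable_const.indicator hE.compl
  have hm : Measurable fun ω => E.indicator (fun _ => ENNReal.ofReal (Real.exp a)) ω +
      Eᶜ.indicator (fun _ => ENNReal.ofReal (Real.exp (-a))) ω := hm1.add hm2
  have hval : ∫⁻ ω, ENNReal.ofReal
      (Real.exp (((E.indicator (fun _ => a) + Eᶜ.indicator fun _ => -a) - X) ω)) ∂μ =
      ENNReal.ofReal (Real.exp a * μ'.real E + Real.exp (-a) * μ'.real Eᶜ) := by
    simp only [hexp]
    rw [ENNReal.ofReal_add (by positivity) (by positivity),
      ENNReal.ofReal_mul (Real.exp_pos _).le, ENNReal.ofReal_mul (Real.exp_pos _).le,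
      ofReal_measureReal, ofReal_measureReal, ← lintegral_indicator_const hE,
      ← lintegral_indicator_const hE.compl, ← lintegral_add_left hm1, hμ',
      lintegral_withDensity_eq_lintegral_mul _ (by fun_prop) hm]
    rfl
  have hsum : μ'.real Eᶜ = 1 - μ'.real E := probReal_compl_eq_one_sub hE
  have hle1 : Real.exp a * μ'.real E + Real.exp (-a) * μ'.real Eᶜ ≤ 1 := by
    have h1 : Real.exp (-a) ≤ Real.exp a := Real.exp_le_exp.2 (by linarith)
    have h2 : Real.exp a * δ + Real.exp (-a) * (1 - δ) = 1 := by
      rw [hea, hea', div_mul_cancel₀ _ hδ0.ne', div_mul_cancel₀ _ (by linarith)]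
      ring
    rw [hsum]
    nlinarith
  rw [hval, ENNReal.ofReal_le_ofReal_iff (by positivity)] at hJ
  have hneg := Real.exp_le_one_iff.1 (hJ.trans hle1)
  rw [integral_sub' (hf1.add hf2) hXi, integral_add' hf1 hf2, integral_indicator_const _ hE,
    integral_indicator_const _ hE.compl, probReal_compl_eq_one_sub hE] at hneg
  have hp' := hp
  rw [probReal_compl_eq_one_sub hE] at hp'
  simp only [smul_eq_mul] at hneg
  nlinarith

end Information

/-- After expansion the difference of the two sides is `(1 - 2x) log (1 - x) + 2x log x + log 2.4`.
The bounds `h1` to `h3` replace it by a tangent line at `0.323`, close to the minimizer, where the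
difference is still slightly positive. -/
theorem log_inv_le_binary_kl {x : ℝ} (hx0 : 0 < x) (hx : x ≤ 1 / 2.4) :
    Real.log (1 / (2.4 * x)) ≤ (1 - 2 * x) * Real.log ((1 - x) / x) := by
  have hx' : x ≤ 5 / 12 := hx.trans_eq (by norm_num)
  have h1x : 0 < 1 - x := by linarith
  -- The logarithmic part of the resulting affine function is controlled at the ends of `[0, 5/12]`:
  -- `f1` at `x = 0`, and `f2`, scaled by six, at `x = 5/12`. The final step interpolates between
  -- them.
  have f1 : 11 / 23 ≤ Real.log (677 / 1000) + Real.log 2.4 := by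
    rw [← Real.log_mul (by norm_num) (by norm_num), Real.le_log_iff_exp_le (by norm_num)]
    refine le_of_pow_le_pow_left₀ (n := 23) (by norm_num) (by norm_num) ?_
    rw [← Real.exp_nat_mul]
    have : ((23 : ℕ) : ℝ) * (11 / 23) = (11 : ℕ) * 1 := by norm_num
    rw [this, Real.exp_nat_mul]
    exact (pow_le_pow_left₀ (Real.exp_pos 1).le Real.exp_one_lt_d9.le 11).trans (by norm_num)
  have f2 : -(4 / 5) ≤ 5 * Real.log (323 / 1000) + Real.log (677 / 1000) + 6 * Real.log 2.4 := by
    have e1 : 5 * Real.log (323 / 1000) + Real.log (677 / 1000) + 6 * Real.log 2.4 =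
        -Real.log (((323 / 1000) ^ 5 * (677 / 1000) * 2.4 ^ 6)⁻¹) := by
      rw [Real.log_inv, neg_neg, Real.log_mul (by norm_num) (by norm_num),
        Real.log_mul (by norm_num) (by norm_num), Real.log_pow, Real.log_pow]
      norm_num
    rw [e1, neg_le_neg_iff, Real.log_le_iff_le_exp (by norm_num)]
    refine le_of_pow_le_pow_left₀ (n := 5) (by norm_num) (Real.exp_pos _).le ?_
    rw [← Real.exp_nat_mul]
    have : ((5 : ℕ) : ℝ) * (4 / 5) = (4 : ℕ) * 1 := by norm_num
    rw [this, Real.exp_nat_mul]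
    refine le_trans ?_ (pow_le_pow_left₀ (by norm_num) Real.exp_one_gt_d9.le 4)
    norm_num
  have h1 : x * Real.log (323 / 1000) + x - 323 / 1000 ≤ x * Real.log x := by
    have := Real.log_le_sub_one_of_pos (div_pos (by norm_num : (0 : ℝ) < 323 / 1000) hx0)
    rw [Real.log_div (by norm_num) hx0.ne'] at this
    have h := mul_le_mul_of_nonneg_left this hx0.le
    rw [mul_sub, mul_sub, mul_div_cancel₀ _ hx0.ne'] at h
    linarith
  have h2 : Real.log (677 / 1000) + 1 - 677 / 1000 / (1 - x) ≤ Real.log (1 - x) := by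
    have := Real.log_le_sub_one_of_pos (div_pos (by norm_num : (0 : ℝ) < 677 / 1000) h1x)
    rw [Real.log_div (by norm_num) h1x.ne'] at this
    linarith
  have h3 : (1 - 2 * x) * (677 / 1000 / (1 - x)) ≤ 2 * (677 / 1000) - 1 -
      (x - 323 / 1000) / (677 / 1000) := by
    rw [mul_div_assoc', div_le_iff₀ h1x]
    nlinarith [sq_nonneg (x - 323 / 1000)]
  have h4 := mul_le_mul_of_nonneg_left h2 (by linarith : 0 ≤ 1 - 2 * x)
  rw [one_div, Real.log_inv, Real.log_mul (by norm_num) hx0.ne', Real.log_div h1x.ne' hx0.ne']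
  have k1 := mul_le_mul_of_nonneg_left f1 (by linarith : 0 ≤ 1 - 12 / 5 * x)
  have k2 := mul_le_mul_of_nonneg_left f2 (by linarith : 0 ≤ 2 / 5 * x)
  nlinarith

/-! ### Lower bounds on the information gathered by a saving policy -/

section LowerBounds

variable {F : ExpFamily} {L : ℕ}

/-- Jensen gives the weak inequality. Equality would make the log-likelihood ratio constant, and two
probability laws with a constant density ratio coincide, against `D > 0`. -/
theorem lt_lintegral_exp_half_llr {θ θ' : F.param} (h : F.kl θ θ' ≠ ∞) {D : ℝ} (hD0 : 0 < D)
    (hD : (F.kl θ θ').toReal ≤ D) :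
    ENNReal.ofReal (Real.exp (-D / 2)) <
      ∫⁻ x, ENNReal.ofReal (Real.exp (-llr (F.law θ) (F.law θ') x / 2)) ∂(F.law θ) := by
  have hi := (integrable_llr_of_kl_ne_top h).neg.div_const 2
  have hint : ∫ x, (-llr (F.law θ) (F.law θ')) x / 2 ∂(F.law θ) = -(F.kl θ θ').toReal / 2 := by
    rw [integral_div, integral_neg', integral_llr_law]
  have hJ := ofReal_exp_integral_le hi
  rw [hint] at hJ
  rcases hD.lt_or_eq with hlt | heq
  · refine lt_of_lt_of_le ?_ hJ
    rw [ENNReal.ofReal_lt_ofReal_iff (Real.exp_pos _), Real.exp_lt_exp]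
    linarith
  · rw [← heq]
    by_contra hcon
    have hae := ae_eq_of_lintegral_exp_le hi (by rw [hint]; exact not_lt.1 hcon)
    rw [hint, heq] at hae
    have h1 := lintegral_law_eq θ θ' (f := fun _ => 1) measurable_const
    have h2 : ∫⁻ x, 1 * ENNReal.ofReal (Real.exp (-llr (F.law θ) (F.law θ') x)) ∂(F.law θ) =
        ∫⁻ _, ENNReal.ofReal (Real.exp (-D)) ∂(F.law θ) := by
      refine lintegral_congr_ae ?_
      filter_upwards [hae] with x hx
      have hx' : -llr (F.law θ) (F.law θ') x / 2 = -D / 2 := hx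
      rw [one_mul]
      congr 2
      linarith
    rw [h2] at h1
    simp only [lintegral_const, measure_univ, mul_one] at h1
    rw [eq_comm, ENNReal.ofReal_eq_one, Real.exp_eq_one_iff] at h1
    linarith

variable [NeZero L]

theorem measureReal_le_of_savesAt {ν ν' : F.Inst L} {π : Policy L} {T n : ℕ} {α β C C' : ℝ}
    (hdisj : ∀ h : Hist L n, ¬ (α * saveStar ν T (n : ℝ) ≤ saveHat ν T h ∧
      α * saveStar ν' T (n : ℝ) ≤ saveHat ν' T h))
    (hs : SavesAt α β C ν π T n) (hs' : SavesAt α β C' ν' π T n) :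
    (histLaw ν π n).real {h | α * saveStar ν T (n : ℝ) ≤ saveHat ν T h}ᶜ ≤
        C * (T : ℝ) ^ (-β) ∧
      (histLaw ν' π n).real {h | α * saveStar ν T (n : ℝ) ≤ saveHat ν T h} ≤
        C' * (T : ℝ) ^ (-β) := by
  constructor
  · rw [probReal_compl_eq_one_sub (measurableSet_le_saveHat ν T n _)]
    unfold SavesAt at hs
    linarith
  · have hsub : {h : Hist L n | α * saveStar ν T (n : ℝ) ≤ saveHat ν T h} ⊆
        {h : Hist L n | α * saveStar ν' T (n : ℝ) ≤ saveHat ν' T h}ᶜ := fun h h1 h2 =>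
      hdisj h ⟨h1, h2⟩
    refine (measureReal_mono hsub).trans ?_
    rw [probReal_compl_eq_one_sub (measurableSet_le_saveHat ν' T n _)]
    unfold SavesAt at hs'
    linarith

theorem sqrt_add_sqrt_le {T : ℕ} (hT : 2 ≤ T) (β C C' : ℝ) :
    √(C' * (T : ℝ) ^ (-β)) + √(C * (T : ℝ) ^ (-β)) ≤
      (√|C'| + √|C|) * Real.exp (-(β * Real.log T) / 2) := by
  have hT0 : (0 : ℝ) < T := by positivity
  have h1 : √((T : ℝ) ^ (-β)) = Real.exp (-(β * Real.log T) / 2) := by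
    rw [Real.rpow_def_of_pos hT0, Real.exp_half]
    congr 2
    ring
  have h2 : ∀ c : ℝ, √(c * (T : ℝ) ^ (-β)) ≤ √|c| * Real.exp (-(β * Real.log T) / 2) := fun c => by
    rw [← h1, ← Real.sqrt_mul (abs_nonneg c)]
    exact Real.sqrt_le_sqrt (mul_le_mul_of_nonneg_right (le_abs_self c) (by positivity))
  rw [add_mul]
  exact add_le_add (h2 C') (h2 C)

/-- Distinguishing two instances requires an amount of information of at least
`β ln T - O(1)`. -/
theorem le_sum_expPulls_mul_kl {ν ν' : F.Inst L} {π : Policy L} {T n : ℕ} {α β C C' : ℝ}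
    (hT : 2 ≤ T) (hkl : ∀ i, F.kl (ν i) (ν' i) ≠ ∞)
    (hdisj : ∀ h : Hist L n, ¬ (α * saveStar ν T (n : ℝ) ≤ saveHat ν T h ∧
      α * saveStar ν' T (n : ℝ) ≤ saveHat ν' T h))
    (hs : SavesAt α β C ν π T n) (hs' : SavesAt α β C' ν' π T n) :
    β * Real.log T - 2 * (√|C'| + √|C|) ≤
      ∑ i, (expPulls ν π n i).toReal * (F.kl (ν i) (ν' i)).toReal := by
  obtain ⟨hp, hq⟩ := measureReal_le_of_savesAt hdisj hs hs'
  have h := (exp_neg_half_integral_le (measurable_histLogRatio ν ν' n)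
    (integrable_histLogRatio π n hkl) (histLaw_eq_withDensity ν ν' π n)
    (measurableSet_le_saveHat ν T n _) hp hq).trans (sqrt_add_sqrt_le hT β C C')
  rw [integral_histLogRatio π n hkl] at h
  set K := √|C'| + √|C| with hK
  -- The bound `K ≤ exp K` turns the multiplicative constant into an additive one without a
  -- logarithm of `K`, which may be zero.
  have h2 := h.trans (mul_le_mul_of_nonneg_right
    ((by linarith : K ≤ K + 1).trans (Real.add_one_le_exp K)) (Real.exp_pos _).le)
  rw [← Real.exp_add, Real.exp_le_exp] at h2
  linarith

/-- The Hellinger affinity of the history laws is at least the power of a one-step lower bound and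
at most the sum of the roots of the test errors. -/
theorem pow_le_exp_of_savesAt {ν ν' : F.Inst L} {π : Policy L} {T n : ℕ} {α β C C' ρ : ℝ}
    (hT : 2 ≤ T) (hρ0 : 0 ≤ ρ)
    (hρ : ∀ i, ENNReal.ofReal ρ ≤ ∫⁻ x, ENNReal.ofReal
      (Real.exp (-llr (F.law (ν i)) (F.law (ν' i)) x / 2)) ∂(F.law (ν i)))
    (hdisj : ∀ h : Hist L n, ¬ (α * saveStar ν T (n : ℝ) ≤ saveHat ν T h ∧
      α * saveStar ν' T (n : ℝ) ≤ saveHat ν' T h))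
    (hs : SavesAt α β C ν π T n) (hs' : SavesAt α β C' ν' π T n) :
    ρ ^ n ≤ (√|C'| + √|C|) * Real.exp (-(β * Real.log T) / 2) := by
  obtain ⟨hp, hq⟩ := measureReal_le_of_savesAt hdisj hs hs'
  have hl := measurable_logRatio ν ν'
  have h1 := lintegral_prod_le ν π
    (φ := fun p => ENNReal.ofReal (Real.exp (-logRatio ν ν' p / 2))) (by fun_prop) hρ n
  have h2 : ∀ h : Hist L n, ∏ t, ENNReal.ofReal (Real.exp (-logRatio ν ν' (h t) / 2)) =
      ENNReal.ofReal (Real.exp (-histLogRatio ν ν' h / 2)) := fun h => by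
    rw [← ENNReal.ofReal_prod_of_nonneg fun _ _ => (Real.exp_pos _).le, ← Real.exp_sum,
      ← Finset.sum_div, Finset.sum_neg_distrib]
    rfl
  simp only [h2] at h1
  have h3 := h1.trans (lintegral_exp_half_le (measurable_histLogRatio ν ν' n)
    (histLaw_eq_withDensity ν ν' π n) (measurableSet_le_saveHat ν T n _) hp hq)
  rw [← ENNReal.ofReal_pow hρ0, ENNReal.ofReal_le_ofReal_iff (by positivity)] at h3
  exact h3.trans (sqrt_add_sqrt_le hT β C C')

end LowerBounds

variable {F : ExpFamily} {L : ℕ}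

theorem pairwise_disjoint_block (c k : ℕ) :
    Pairwise fun j j' : ℕ => Disjoint (block (L := L) c k j) (block c k j') := by
  have key : ∀ j j' : ℕ, j < j' → Disjoint (block (L := L) c k j) (block c k j') := by
    intro j j' hj
    rw [Finset.disjoint_left]
    intro i hi hi'
    have h1 := (Finset.mem_filter.1 hi).2.2
    have h2 := (Finset.mem_filter.1 hi').2.1
    have h3 : (j + 1) * k ≤ j' * k := Nat.mul_le_mul_right k hj
    omega
  intro j j' hj
  rcases hj.lt_or_gt with h | h
  · exact key j j' h
  · exact (key j' j h).symm

variable [NeZero L]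

/-! ### Small free budgets -/

theorem two_le_of_lt_div {β : ℝ} {T n : ℕ} {x : ℝ≥0∞}
    (h : (n : ℝ≥0∞) < ENNReal.ofReal (β * Real.log T) / x) : 2 ≤ T := by
  by_contra! hT
  -- The logarithm vanishes at `0` and `1`, which leaves no room below the quotient.
  interval_cases T <;> simp at h

theorem natCast_mul_toReal_lt {b : ℝ} (hb : 0 < b) {n : ℕ} {x : ℝ≥0∞}
    (h : (n : ℝ≥0∞) < ENNReal.ofReal b / x) : n * x.toReal < b := by
  rcases eq_or_ne x 0 with rfl | h0
  · simpa using hb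
  rcases eq_or_ne x ∞ with rfl | htop
  · simpa using hb
  have h1 := (ENNReal.lt_div_iff_mul_lt (Or.inl h0) (Or.inl htop)).1 h
  have h2 := ENNReal.toReal_lt_of_lt_ofReal h1
  simpa using h2

theorem ne_top_of_lt_div {b : ℝ} {n : ℕ} {x : ℝ≥0∞}
    (h : (n : ℝ≥0∞) < ENNReal.ofReal b / x) : x ≠ ∞ := by
  rintro rfl
  simp at h

theorem eq_of_kl_eq_zero {θ θ' : F.param} (h : F.kl θ θ' = 0) : θ = θ' := by
  have := InformationTheory.klDiv_eq_zero_iff.1 h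
  exact F.mean_injective (by rw [ExpFamily.mean, ExpFamily.mean, this])

theorem IsAltOne.iSup_kl_ne_zero {ν : F.Inst L} (hν : Antitone fun i => F.mean (ν i)) {α : ℝ}
    (hα : α ∈ Set.Ioo (0 : ℝ) 1) {T n : ℕ} (hT : 2 ≤ T) {ε : ℝ} {ν₁ : F.Inst L}
    (hA : IsAltOne α ν T n ε ν₁) : ⨆ i, F.kl (ν i) (ν₁ i) ≠ 0 := by
  intro h0
  have heq : ∀ i, ν i = ν₁ i := fun i => eq_of_kl_eq_zero (ENNReal.iSup_eq_zero.1 h0 i)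
  obtain ⟨hε, ⟨i, hi⟩, hin, hout, -⟩ := hA
  have h1 := hν (le_top : i ≤ ⊤)
  simp only [heq] at h1
  have h2 := hin i hi
  have h3 := hout ⊤ (top_notMem_goodItems hν hα hT)
  rw [h2, h3] at h1
  linarith

theorem not_isProbablySaving_altOne {ν : F.Inst L} (hν : Antitone fun i => F.mean (ν i))
    {α β : ℝ} (hα : α ∈ Set.Ioo (0 : ℝ) 1) (hβ : 0 < β) {g : ℕ → ℕ}
    (hg : Tendsto g atTop atTop) {π : ℕ → Policy L} {ν₁ : F.Inst L} {ε : ℝ}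
    (hfreq : ∃ᶠ T : ℕ in atTop, IsAltOne α ν T (g T) ε ν₁ ∧
      (g T : ℝ≥0∞) < ENNReal.ofReal (β * Real.log T) / ⨆ i, F.kl (ν i) (ν₁ i)) :
    ¬ IsProbablySaving α β g π {ν, ν₁} := by
  intro hsav
  obtain ⟨C, hC⟩ := hsav ν (by simp)
  obtain ⟨C', hC'⟩ := hsav ν₁ (by simp)
  obtain ⟨T₀, hA₀, hT₀⟩ := hfreq.exists
  have htop := ne_top_of_lt_div hT₀
  have hzero := hA₀.iSup_kl_ne_zero hν hα (two_le_of_lt_div hT₀)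
  set D := (⨆ i, F.kl (ν i) (ν₁ i)).toReal with hD
  have hD0 : 0 < D := ENNReal.toReal_pos hzero htop
  have hkl : ∀ i, F.kl (ν i) (ν₁ i) ≤ ⨆ i, F.kl (ν i) (ν₁ i) := fun i =>
    le_iSup (fun i => F.kl (ν i) (ν₁ i)) i
  have hlt : ∀ i, ENNReal.ofReal (Real.exp (-D / 2)) < ∫⁻ x, ENNReal.ofReal
      (Real.exp (-llr (F.law (ν i)) (F.law (ν₁ i)) x / 2)) ∂(F.law (ν i)) := fun i =>
    lt_lintegral_exp_half_llr (ne_top_of_le_ne_top htop (hkl i)) hD0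
      (ENNReal.toReal_mono htop (hkl i))
  -- Finitely many items, so one `ρ > exp (-D / 2)`, independent of `T`, serves them all.
  obtain ⟨m, -, hm⟩ := Finset.univ.exists_min_image (fun i => ∫⁻ x, ENNReal.ofReal
    (Real.exp (-llr (F.law (ν i)) (F.law (ν₁ i)) x / 2)) ∂(F.law (ν i))) ⟨0, Finset.mem_univ _⟩
  obtain ⟨ρ, hρ0, hρ1, hρ2⟩ := ENNReal.lt_iff_exists_real_btwn.1 (hlt m)
  rw [ENNReal.ofReal_lt_ofReal_iff_of_nonneg (Real.exp_pos _).le] at hρ1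
  have hbase : 1 < ρ * Real.exp (D / 2) := by
    have := mul_lt_mul_of_pos_right hρ1 (Real.exp_pos (D / 2))
    rwa [← Real.exp_add, show -D / 2 + D / 2 = 0 by ring, Real.exp_zero] at this
  have hgrow := ((tendsto_pow_atTop_atTop_of_one_lt hbase).comp hg).eventually_gt_atTop
    (√|C'| + √|C|)
  obtain ⟨T, ⟨hA, hT⟩, hs, hs', hbig⟩ := (hfreq.and_eventually (hC.and (hC'.and hgrow))).exists
  have hT2 := two_le_of_lt_div hT
  have hnD : g T * D < β * Real.log T :=
    natCast_mul_toReal_lt (mul_pos hβ (log_pos_of_two_le hT2)) hT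
  have h1 := pow_le_exp_of_savesAt hT2 hρ0 (fun i => hρ2.le.trans (hm i (Finset.mem_univ i)))
    (not_saves_and_saves_altOne hν hα hT2 hA) hs hs'
  have h2 : ρ ^ g T * Real.exp (D / 2) ^ g T ≤ √|C'| + √|C| := by
    calc ρ ^ g T * Real.exp (D / 2) ^ g T
        ≤ (√|C'| + √|C|) * Real.exp (-(β * Real.log T) / 2) * Real.exp (D / 2) ^ g T := by
          gcongr
      _ = (√|C'| + √|C|) * Real.exp (-(β * Real.log T) / 2 + g T * (D / 2)) := by
          rw [← Real.exp_nat_mul, mul_assoc, ← Real.exp_add]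
      _ ≤ (√|C'| + √|C|) * 1 := by
          gcongr
          rw [Real.exp_le_one_iff]
          linarith
      _ = _ := mul_one _
  rw [← mul_pow] at h2
  exact absurd hbig (not_lt.2 h2)

/-- With `δ = T ^ (-β) / 2.4` the numerical bound reads `β ln T` exactly, more information than `n`
pulls can carry. -/
theorem not_savesAt_altOne {ν : F.Inst L} (hν : Antitone fun i => F.mean (ν i))
    {α β : ℝ} (hα : α ∈ Set.Ioo (0 : ℝ) 1) (hβ : 0 < β) {π : Policy L} {ν₁ : F.Inst L} {ε : ℝ}
    {T n : ℕ} (hA : IsAltOne α ν T n ε ν₁)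
    (hn : (n : ℝ≥0∞) < ENNReal.ofReal (β * Real.log T) / ⨆ i, F.kl (ν i) (ν₁ i)) :
    ¬ (SavesAt α β (1 / 2.4) ν π T n ∧ SavesAt α β (1 / 2.4) ν₁ π T n) := by
  rintro ⟨hs, hs'⟩
  have hT2 := two_le_of_lt_div hn
  have htop := ne_top_of_lt_div hn
  have hkl : ∀ i, F.kl (ν i) (ν₁ i) ≤ ⨆ i, F.kl (ν i) (ν₁ i) := fun i =>
    le_iSup (fun i => F.kl (ν i) (ν₁ i)) i
  have hkl' : ∀ i, F.kl (ν i) (ν₁ i) ≠ ∞ := fun i => ne_top_of_le_ne_top htop (hkl i)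
  obtain ⟨hp, hq⟩ := measureReal_le_of_savesAt (not_saves_and_saves_altOne hν hα hT2 hA) hs hs'
  have hT0 : (0 : ℝ) < T := by positivity
  have hTβ : (0 : ℝ) < (T : ℝ) ^ (-β) := Real.rpow_pos_of_pos hT0 _
  have hTβ1 : (T : ℝ) ^ (-β) ≤ 1 :=
    Real.rpow_le_one_of_one_le_of_nonpos (by exact_mod_cast (by omega : 1 ≤ T)) (by linarith)
  have hδ0 : 0 < 1 / 2.4 * (T : ℝ) ^ (-β) := by positivity
  have hδ1 : 1 / 2.4 * (T : ℝ) ^ (-β) ≤ 1 / 2.4 := mul_le_of_le_one_right (by norm_num) hTβ1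
  have h1 := (log_inv_le_binary_kl hδ0 hδ1).trans <|
    binary_kl_le_integral (measurable_histLogRatio ν ν₁ n) (integrable_histLogRatio π n hkl')
      (histLaw_eq_withDensity ν ν₁ π n) (measurableSet_le_saveHat ν T n _) hδ0
      (hδ1.trans (by norm_num)) hp hq
  have h2 : Real.log (1 / (2.4 * (1 / 2.4 * (T : ℝ) ^ (-β)))) = β * Real.log T := by
    rw [← mul_assoc, mul_one_div_cancel (by norm_num), one_mul, one_div, Real.log_inv,
      Real.log_rpow hT0]
    ring
  rw [h2, integral_histLogRatio π n hkl'] at h1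
  have h3 : ∑ i, (expPulls ν π n i).toReal * (F.kl (ν i) (ν₁ i)).toReal ≤
      n * (⨆ i, F.kl (ν i) (ν₁ i)).toReal := by
    rw [← sum_toReal_expPulls ν π n, Finset.sum_mul]
    refine Finset.sum_le_sum fun i _ => ?_
    exact mul_le_mul_of_nonneg_left (ENNReal.toReal_mono htop (hkl i)) ENNReal.toReal_nonneg
  have h4 := natCast_mul_toReal_lt (mul_pos hβ (log_pos_of_two_le hT2)) hn
  linarith

/-! ### The bound on the saved regret -/

theorem maxGap_nonneg (ν : F.Inst L) (S : Finset (Fin L)) : 0 ≤ maxGap ν S := by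
  refine Real.sSup_nonneg ?_
  rintro _ ⟨i, -, rfl⟩
  exact gap_nonneg ν i

/-- Permissible sets lie strictly below `iFE`, so no group reaches the last item and `firstOutside`
is meaningful. -/
theorem IsGrouping.compl_block_nonempty {α : ℝ} {ν : F.Inst L} {T n c k J : ℕ}
    (h : IsGrouping α ν T n c k J) (hJ : J ≠ 0) (j : ℕ) :
    (block (L := L) c k j)ᶜ.Nonempty := by
  rcases h with h | ⟨⟨⟨S, hS, i, hi, hic⟩, -⟩, -⟩
  · exact absurd h hJ
  refine ⟨⊤, Finset.mem_compl.2 fun htop => ?_⟩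
  have h1 := (Finset.mem_filter.1 htop).2.1
  have h2 : i < ⊤ := (hS.1 i hi).trans_le le_top
  rw [Fin.lt_def] at h2
  omega

/-- A probably saving policy explores the changed items at the rate `exploreRate`. -/
theorem exists_le_sum_expPulls {ν ν₂ : F.Inst L} {S : Finset (Fin L)} {ε : ℝ}
    (hA : IsAltTwo ν S ε ν₂) {α β : ℝ} (hβ : 0 ≤ β) {g : ℕ → ℕ} {π : ℕ → Policy L}
    (hs : ∃ C : ℝ, ∀ᶠ T : ℕ in atTop, SavesAt α β C ν (π T) T (g T))
    (hs' : ∃ C : ℝ, ∀ᶠ T : ℕ in atTop, SavesAt α β C ν₂ (π T) T (g T))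
    (hdisj : ∀ᶠ T : ℕ in atTop, ∀ h : Hist L (g T),
      ¬ (α * saveStar ν T (g T : ℝ) ≤ saveHat ν T h ∧
        α * saveStar ν₂ T (g T : ℝ) ≤ saveHat ν₂ T h)) :
    ∃ c : ℝ, 0 ≤ c ∧ ∀ᶠ T : ℕ in atTop, exploreRate β ν ν₂ S * Real.log T - c ≤
      ∑ i ∈ S, (expPulls ν (π T) (g T) i).toReal := by
  set M := S.sup (fun i => F.kl (ν i) (ν₂ i)) with hM
  have hr : exploreRate β ν ν₂ S = β / M.toReal := by
    rw [exploreRate, ← hM, ENNReal.toReal_div, ENNReal.toReal_ofReal hβ]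
  -- This covers `M = 0` and `M = ∞`; in both cases `exploreRate` is `0` as a real number.
  rcases eq_or_ne M.toReal 0 with h0 | h0
  · refine ⟨0, le_rfl, Eventually.of_forall fun T => ?_⟩
    rw [hr, h0, div_zero, zero_mul, sub_zero]
    exact Finset.sum_nonneg fun _ _ => ENNReal.toReal_nonneg
  have hMtop : M ≠ ∞ := fun h => h0 (by simp [h])
  have hMpos : 0 < M.toReal := lt_of_le_of_ne ENNReal.toReal_nonneg h0.symm
  have hin : ∀ i ∈ S, F.kl (ν i) (ν₂ i) ≤ M := fun i hi =>
    Finset.le_sup (f := fun i => F.kl (ν i) (ν₂ i)) hi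
  have hout : ∀ i ∉ S, F.kl (ν i) (ν₂ i) = 0 := fun i hi => by rw [hA.2 i hi, F.kl_self]
  have hkl : ∀ i, F.kl (ν i) (ν₂ i) ≠ ∞ := fun i => by
    by_cases hi : i ∈ S
    · exact ne_top_of_le_ne_top hMtop (hin i hi)
    · rw [hout i hi]; exact ENNReal.zero_ne_top
  obtain ⟨C, hC⟩ := hs
  obtain ⟨C', hC'⟩ := hs'
  refine ⟨2 * (√|C'| + √|C|) / M.toReal, by positivity, ?_⟩
  filter_upwards [hC, hC', hdisj, eventually_ge_atTop 2] with T h1 h2 h3 hT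
  have h4 := le_sum_expPulls_mul_kl hT hkl h3 h1 h2
  have h5 : ∑ i, (expPulls ν (π T) (g T) i).toReal * (F.kl (ν i) (ν₂ i)).toReal ≤
      (∑ i ∈ S, (expPulls ν (π T) (g T) i).toReal) * M.toReal := by
    rw [← Finset.sum_subset (Finset.subset_univ S) fun i _ hi => by simp [hout i hi],
      Finset.sum_mul]
    refine Finset.sum_le_sum fun i hi => ?_
    exact mul_le_mul_of_nonneg_left (ENNReal.toReal_mono hMtop (hin i hi)) ENNReal.toReal_nonneg
  rw [hr, div_mul_eq_mul_div, ← sub_div, div_le_iff₀ hMpos]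
  exact h4.trans h5

/-- The allocation `x` contains an allocation `y` that uses at most `ℓ j` on the group `S j`, and
only misses what `x` itself misses there. -/
theorem exists_le_of_groups {ι κ : Type*} [Fintype ι] [DecidableEq ι] [Fintype κ]
    {S : κ → Finset ι} (hS : Pairwise fun j j' => Disjoint (S j) (S j')) {x : ι → ℝ}
    (hx : ∀ i, 0 ≤ x i) {d : ι → ℝ} {ℓ c m : κ → ℝ} (hℓ : ∀ j, 0 ≤ ℓ j) (hc : ∀ j, 0 ≤ c j)
    (hm : ∀ j, 0 ≤ m j) (hd : ∀ j, ∀ i ∈ S j, d i ≤ m j)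
    (h : ∀ j, ℓ j - c j ≤ ∑ i ∈ S j, x i) :
    ∃ y : ι → ℝ, (∀ i, 0 ≤ y i) ∧ (∀ i, y i ≤ x i) ∧ ∑ j, ℓ j - ∑ j, c j ≤ ∑ i, y i ∧
      ∑ i, d i * y i ≤ ∑ j, ℓ j * m j := by
  -- Each group is scaled down uniformly, and only if its total exceeds `ℓ j`.
  have hlam : ∀ j, ∃ t : ℝ, 0 ≤ t ∧ t ≤ 1 ∧ t * ∑ i ∈ S j, x i ≤ ℓ j ∧
      ℓ j - c j ≤ t * ∑ i ∈ S j, x i := by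
    intro j
    rcases le_or_gt (∑ i ∈ S j, x i) (ℓ j) with hj | hj
    · exact ⟨1, zero_le_one, le_rfl, by simpa using hj, by simpa using h j⟩
    · have hpos : 0 < ∑ i ∈ S j, x i := (hℓ j).trans_lt hj
      refine ⟨ℓ j / ∑ i ∈ S j, x i, div_nonneg (hℓ j) hpos.le, (div_le_one hpos).2 hj.le, ?_, ?_⟩
      · rw [div_mul_cancel₀ _ hpos.ne']
      · rw [div_mul_cancel₀ _ hpos.ne']
        linarith [hc j]
  choose t ht0 ht1 htu htl using hlam
  have hswap : ∀ e : ι → ℝ, ∑ i, e i * ∑ j, (if i ∈ S j then t j * x i else 0) =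
      ∑ j, ∑ i ∈ S j, e i * (t j * x i) := fun e => by
    simp only [Finset.mul_sum, mul_ite, mul_zero]
    rw [Finset.sum_comm]
    simp only [Finset.sum_ite_mem, Finset.univ_inter]
  refine ⟨fun i => ∑ j, if i ∈ S j then t j * x i else 0, fun i => ?_, fun i => ?_, ?_, ?_⟩
  · exact Finset.sum_nonneg fun j _ => by
      split_ifs
      exacts [mul_nonneg (ht0 j) (hx i), le_rfl]
  · by_cases hi : ∃ j, i ∈ S j
    · obtain ⟨j, hj⟩ := hi
      dsimp only
      rw [Finset.sum_eq_single j (fun j' _ hj' => if_neg fun hi' =>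
        Finset.disjoint_left.1 (hS hj') hi' hj) (by simp), if_pos hj]
      exact mul_le_of_le_one_left (hx i) (ht1 j)
    · push Not at hi
      simp [hi, hx i]
  · have := hswap fun _ => 1
    simp only [one_mul] at this
    rw [this, ← Finset.sum_sub_distrib]
    refine Finset.sum_le_sum fun j _ => ?_
    rw [← Finset.mul_sum]
    exact htl j
  · rw [hswap]
    refine Finset.sum_le_sum fun j _ => ?_
    calc ∑ i ∈ S j, d i * (t j * x i) ≤ ∑ i ∈ S j, m j * (t j * x i) :=
          Finset.sum_le_sum fun i hi =>
            mul_le_mul_of_nonneg_right (hd j i hi) (mul_nonneg (ht0 j) (hx i))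
      _ = (t j * ∑ i ∈ S j, x i) * m j := by
          rw [← Finset.mul_sum, ← Finset.mul_sum, mul_comm]
      _ ≤ ℓ j * m j := mul_le_mul_of_nonneg_right (htu j) (hm j)

theorem saveTilde_le {ν : F.Inst L} (hν : Antitone fun i => F.mean (ν i)) {π : Policy L}
    {T n J : ℕ} {S : Fin J → Finset (Fin L)}
    (hS : Pairwise fun j j' => Disjoint (S j) (S j')) {ℓ c : Fin J → ℝ} (hℓ : ∀ j, 0 ≤ ℓ j)
    (hc : ∀ j, 0 ≤ c j) (h : ∀ j, ℓ j - c j ≤ ∑ i ∈ S j, (expPulls ν π n i).toReal) :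
    saveTilde ν π T n ≤ ∑ j, ℓ j * maxGap ν (S j) + saveStar ν T (n - ∑ j, ℓ j) +
      gap ν ⊤ * ∑ j, c j := by
  obtain ⟨y, hy0, hyx, hysum, hyd⟩ := exists_le_of_groups hS
    (x := fun i => (expPulls ν π n i).toReal) (fun _ => ENNReal.toReal_nonneg) (d := gap ν) hℓ hc
    (fun j => maxGap_nonneg ν (S j)) (fun j i hi => le_maxGap ν hi) h
  set x : Fin L → ℝ := fun i => (expPulls ν π n i).toReal with hx
  set m : Fin L → ℝ := fun i => (min (cap ν T i) (expPulls ν π n i)).toReal with hm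
  have hmx : ∀ i, m i ≤ x i := fun i =>
    ENNReal.toReal_mono (expPulls_ne_top ν π n i) (min_le_right _ _)
  have hmc : ∀ i, ENNReal.ofReal (m i) ≤ cap ν T i := fun i =>
    ENNReal.ofReal_toReal_le.trans (min_le_left _ _)
  have h1 : saveTilde ν π T n ≤ ∑ i, gap ν i * m i :=
    Finset.sum_le_sum_of_subset_of_nonneg (Finset.filter_subset _ _) fun i _ _ =>
      mul_nonneg (gap_nonneg ν i) ENNReal.toReal_nonneg
  -- The part of the capped pulls left for the residual knapsack: it respects the caps, and its
  -- total exceeds the residual budget by at most `∑ j, c j`.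
  set u : Fin L → ℝ := fun i => min (m i) (x i - y i) with hu
  have hu0 : ∀ i, 0 ≤ u i := fun i => le_min ENNReal.toReal_nonneg (sub_nonneg.2 (hyx i))
  have huc : ∀ i, ENNReal.ofReal (u i) ≤ cap ν T i := fun i =>
    (ENNReal.ofReal_le_ofReal (min_le_left _ _)).trans (hmc i)
  set B : ℝ := n - ∑ j, ℓ j with hB
  have h2 := sum_mul_le_greedy (monotone_gap hν) B hu0 huc
  rw [← saveStar_eq_greedy_of_antitone hν] at h2
  have h3 : ∑ i, u i - B ≤ ∑ j, c j := by
    have : ∑ i, u i ≤ ∑ i, (x i - y i) := Finset.sum_le_sum fun i _ => min_le_right _ _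
    rw [Finset.sum_sub_distrib, sum_toReal_expPulls] at this
    linarith
  have h4 : gap ν (threshold (cap ν T) B) * (∑ i, u i - B) ≤ gap ν ⊤ * ∑ j, c j :=
    (mul_le_mul_of_nonneg_left h3 (gap_nonneg ν _)).trans
      (mul_le_mul_of_nonneg_right (monotone_gap hν le_top) (Finset.sum_nonneg fun j _ => hc j))
  have h5 : ∀ i, m i ≤ y i + u i := fun i => by
    have : m i - y i ≤ u i := le_min (by linarith [hy0 i]) (by linarith [hmx i])
    linarith
  have h6 : ∑ i, gap ν i * m i ≤ ∑ i, gap ν i * y i + ∑ i, gap ν i * u i := by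
    rw [← Finset.sum_add_distrib]
    refine Finset.sum_le_sum fun i _ => ?_
    rw [← mul_add]
    exact mul_le_mul_of_nonneg_left (h5 i) (gap_nonneg ν i)
  linarith

theorem abs_saveStar_div_log_le {ν : F.Inst L} (hν : Antitone fun i => F.mean (ν i)) {T : ℕ}
    (hT : 2 ≤ T) (B : ℝ) : |saveStar ν T B / Real.log T| ≤ gap ν ⊤ * |B / Real.log T| := by
  have hl := log_pos_of_two_le hT
  rw [abs_div, abs_div, abs_of_pos hl, ← mul_div_assoc]
  exact div_le_div_of_nonneg_right (abs_saveStar_le hν hT B) hl.le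

/-- The bounds on `u` and `v` are what makes the real-valued `limsup` meaningful. -/
theorem limsup_le_add_limsup {u v e : ℕ → ℝ} {A K : ℝ} (hu : ∀ᶠ T in atTop, 0 ≤ u T)
    (hv : ∀ᶠ T in atTop, |v T| ≤ K) (he : Tendsto e atTop (𝓝 0))
    (h : ∀ᶠ T in atTop, u T ≤ A + v T + e T) : limsup u atTop ≤ A + limsup v atTop := by
  have hbv : IsBoundedUnder (· ≤ ·) atTop v :=
    isBoundedUnder_of_eventually_le (hv.mono fun T hT => (abs_le.1 hT).2)
  have hcu : IsCoboundedUnder (· ≤ ·) atTop u :=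
    (isBoundedUnder_of_eventually_ge hu).isCoboundedUnder_le
  refine le_of_forall_pos_le_add fun ε hε => limsup_le_of_le hcu ?_
  filter_upwards [eventually_lt_of_limsup_lt (lt_add_of_pos_right (limsup v atTop) (half_pos hε))
    hbv, he.eventually_lt_const (half_pos hε), h] with T h1 h2 h3
  linarith

/-- By homogeneity the quotient is a fixed greedy function of `b T`, and that function is Lipschitz.
-/
theorem tendsto_saveStar_div_log {ν : F.Inst L} (hν : Antitone fun i => F.mean (ν i))
    {b : ℕ → ℝ} {γ : ℝ} (hb : Tendsto b atTop (𝓝 γ)) :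
    Tendsto (fun T : ℕ => saveStar ν T (b T * Real.log T) / Real.log T) atTop
      (𝓝 (greedy (gap ν) (fun i => (F.kl (ν i) (ν 0))⁻¹) γ)) := by
  have hcont : Continuous (greedy (gap ν) fun i => (F.kl (ν i) (ν 0))⁻¹) := by
    refine (LipschitzWith.of_dist_le_mul (K := ⟨gap ν ⊤, gap_nonneg ν ⊤⟩) fun B' B => ?_).continuous
    exact abs_greedy_sub_le (monotone_gap hν) (gap_nonneg ν) (by simp [F.kl_self]) B B'
  refine ((hcont.tendsto γ).comp hb).congr' ?_
  filter_upwards [eventually_ge_atTop 2] with T hT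
  rw [saveStar_mul_log hν hT, mul_div_cancel_right₀ _ (log_pos_of_two_le hT).ne']
  rfl

theorem tendsto_natCast_log_atTop : Tendsto (fun T : ℕ => Real.log T) atTop atTop :=
  Real.tendsto_log_atTop.comp tendsto_natCast_atTop_atTop

theorem limsup_saveTilde_le {ν : F.Inst L} (hν : Antitone fun i => F.mean (ν i))
    {α β : ℝ} (hα : α ∈ Set.Ioo (0 : ℝ) 1) (hβ : 0 ≤ β) {g : ℕ → ℕ}
    (hg : Tendsto g atTop atTop)
    (hg_log : (fun T : ℕ => (g T : ℝ)) =O[atTop] (fun T : ℕ => Real.log T))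
    {π : ℕ → Policy L} {c k J : ℕ} {ε : Fin J → ℝ} {ν₂ : Fin J → F.Inst L} {r : Fin J → ℝ}
    (hgr : ∀ᶠ T : ℕ in atTop, IsGrouping α ν T (g T) c k J ∧
      ∀ j : Fin J, ε j ∈ permissibleShifts α ν T (g T) (block c k j))
    (hA : ∀ j : Fin J, IsAltTwo ν (block c k j) (ε j) (ν₂ j))
    (hs : IsProbablySaving α β g π (insert ν (Set.range ν₂)))
    (hr : ∀ j : Fin J, r j = exploreRate β ν (ν₂ j) (block c k j)) :
    limsup (fun T : ℕ => saveTilde ν (π T) T (g T) / Real.log T) atTop ≤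
      ∑ j, r j * maxGap ν (block c k j) +
        limsup (fun T : ℕ => saveStar ν T ((g T : ℝ) - ∑ j, r j * Real.log T) / Real.log T)
          atTop := by
  have hex : ∀ j : Fin J, ∃ d : ℝ, 0 ≤ d ∧ ∀ᶠ T : ℕ in atTop, r j * Real.log T - d ≤
      ∑ i ∈ block c k j, (expPulls ν (π T) (g T) i).toReal := fun j => by
    rw [hr j]
    refine exists_le_sum_expPulls (hA j) hβ (hs ν (Set.mem_insert _ _))
      (hs (ν₂ j) (Set.mem_insert_of_mem _ ⟨j, rfl⟩)) ?_
    -- A positive budget is needed for the two saving events to exclude each other.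
    filter_upwards [hgr, hg.eventually_gt_atTop 0] with T hT hgT
    exact not_saves_and_saves_altTwo hν hα hgT
      (hT.1.compl_block_nonempty (Fin.pos j).ne' j) (hT.2 j) (hA j)
  choose d hd0 hd using hex
  have hr0 : ∀ j, 0 ≤ r j := fun j => (hr j).symm ▸ ENNReal.toReal_nonneg
  obtain ⟨K, hK⟩ := hg_log.bound
  refine limsup_le_add_limsup (K := gap ν ⊤ * (K + ∑ j, r j))
    (e := fun T => gap ν ⊤ * ∑ j, d j / Real.log T) ?_ ?_ ?_ ?_
  · filter_upwards [eventually_ge_atTop 2] with T hT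
    exact div_nonneg (Finset.sum_nonneg fun i _ =>
      mul_nonneg (gap_nonneg ν i) ENNReal.toReal_nonneg) (log_pos_of_two_le hT).le
  · filter_upwards [hK, eventually_ge_atTop 2] with T h1 hT
    have hl := log_pos_of_two_le hT
    refine (abs_saveStar_div_log_le hν hT _).trans (mul_le_mul_of_nonneg_left ?_ (gap_nonneg ν _))
    rw [abs_div, abs_of_pos hl, div_le_iff₀ hl, ← Finset.sum_mul]
    rw [Real.norm_natCast, Real.norm_of_nonneg hl.le] at h1
    have h2 : 0 ≤ (∑ j, r j) * Real.log T :=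
      mul_nonneg (Finset.sum_nonneg fun j _ => hr0 j) hl.le
    have h3 : (0 : ℝ) ≤ g T := Nat.cast_nonneg _
    rw [abs_le]
    constructor <;> nlinarith
  · have : ∀ j, Tendsto (fun T : ℕ => d j / Real.log T) atTop (𝓝 0) := fun j =>
      tendsto_const_nhds.div_atTop tendsto_natCast_log_atTop
    simpa using (tendsto_finsetSum Finset.univ fun j _ => this j).const_mul (gap ν ⊤)
  · filter_upwards [eventually_all.2 hd, eventually_ge_atTop 2] with T h1 hT
    have hl := log_pos_of_two_le hT
    have h2 := saveTilde_le (T := T) hν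
      (fun j j' hj => pairwise_disjoint_block c k (Fin.val_injective.ne hj))
      (fun j => mul_nonneg (hr0 j) hl.le) hd0 h1
    rw [div_le_iff₀ hl, add_mul, add_mul, div_mul_cancel₀ _ hl.ne', ← Finset.sum_div, mul_assoc,
      div_mul_cancel₀ _ hl.ne', Finset.sum_mul]
    refine h2.trans_eq ?_
    congr 2
    exact Finset.sum_congr rfl fun j _ => by ring

end FreeExploration

/-! ### Assembly of the two parts -/

theorem mainTheorem8 (F : FreeExploration.ExpFamily) (L : ℕ) [NeZero L]
    (ν : F.Inst L) (hν : Antitone (fun i => F.mean (ν i)))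
    (α β : ℝ) (hα : α ∈ Set.Ioo (0 : ℝ) 1) (hβ : β ∈ Set.Ioo (0 : ℝ) 1)
    (g : ℕ → ℕ) (hg_top : Tendsto g atTop atTop)
    (hg_log : (fun T : ℕ => (g T : ℝ)) =O[atTop] (fun T : ℕ => Real.log T))
    (π : ℕ → FreeExploration.Policy L) :
    -- first part: the free budget is too small
    (∀ (ν₁ : F.Inst L) (ε₁ : ℝ),
      ((∃ᶠ T : ℕ in atTop, FreeExploration.IsAltOne α ν T (g T) ε₁ ν₁ ∧
          (g T : ℝ≥0∞) < ENNReal.ofReal (β * Real.log T) / ⨆ i, F.kl (ν i) (ν₁ i)) →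
        ¬ FreeExploration.IsProbablySaving α β g π {ν, ν₁}) ∧
      (∀ T : ℕ, FreeExploration.IsAltOne α ν T (g T) ε₁ ν₁ →
        (g T : ℝ≥0∞) < ENNReal.ofReal (β * Real.log T) / ⨆ i, F.kl (ν i) (ν₁ i) →
        ¬ (FreeExploration.SavesAt α β (1 / 2.4) ν (π T) T (g T) ∧
           FreeExploration.SavesAt α β (1 / 2.4) ν₁ (π T) T (g T)))) ∧
    -- second part: the bound on the saved regret
    (∀ (c k J : ℕ) (ε : Fin J → ℝ) (ν₂ : Fin J → F.Inst L) (r : Fin J → ℝ),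
      (∀ᶠ T : ℕ in atTop, FreeExploration.IsGrouping α ν T (g T) c k J ∧
        ∀ j : Fin J, ε j ∈
          FreeExploration.permissibleShifts α ν T (g T) (FreeExploration.block c k j)) →
      (∀ j : Fin J, FreeExploration.IsAltTwo ν (FreeExploration.block c k j) (ε j) (ν₂ j)) →
      FreeExploration.IsProbablySaving α β g π (insert ν (Set.range ν₂)) →
      (∀ j : Fin J, r j =
        FreeExploration.exploreRate β ν (ν₂ j) (FreeExploration.block c k j)) →
      limsup (fun T : ℕ => FreeExploration.saveTilde ν (π T) T (g T) / Real.log T) atTop ≤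
          ∑ j, r j * FreeExploration.maxGap ν (FreeExploration.block c k j) +
            limsup (fun T : ℕ => FreeExploration.saveStar ν T
              ((g T : ℝ) - ∑ j, r j * Real.log T) / Real.log T) atTop ∧
        ∀ γ : ℝ, Tendsto (fun T : ℕ => (g T : ℝ) / Real.log T) atTop (𝓝 γ) →
          ∃ l : ℝ,
            Tendsto (fun T : ℕ => FreeExploration.saveStar ν T
              ((g T : ℝ) - ∑ j, r j * Real.log T) / Real.log T) atTop (𝓝 l) ∧
            limsup (fun T : ℕ => FreeExploration.saveTilde ν (π T) T (g T) / Real.log T) atTop ≤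
              ∑ j, r j * FreeExploration.maxGap ν (FreeExploration.block c k j) + l) := by
  refine ⟨fun ν₁ ε₁ => ⟨fun hfreq =>
    FreeExploration.not_isProbablySaving_altOne hν hα hβ.1 hg_top hfreq, fun T hA hT =>
    FreeExploration.not_savesAt_altOne hν hα hβ.1 hA hT⟩,
    fun c k J ε ν₂ r hgr hA hs hr => ?_⟩
  have hle := FreeExploration.limsup_saveTilde_le hν hα hβ.1.le hg_top hg_log hgr hA hs hr
  refine ⟨hle, fun γ hγ => ?_⟩
  have hlim := (FreeExploration.tendsto_saveStar_div_log hν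
    (hγ.sub_const (∑ j, r j))).congr' (f₂ := fun T : ℕ => FreeExploration.saveStar ν T
      ((g T : ℝ) - ∑ j, r j * Real.log T) / Real.log T) <| by
    filter_upwards [eventually_ge_atTop 2] with T hT
    rw [sub_mul, div_mul_cancel₀ _ (FreeExploration.log_pos_of_two_le hT).ne', Finset.sum_mul]
  exact ⟨_, hlim, hlim.limsup_eq ▸ hle⟩
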